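/- Let $\mathcal M$ be a compact connected orientable smooth surface without boundary with a smooth area form $\omega$, and equip it with a smooth Riemannian metric whose area form is $\pm\omega$. Let $X$ be a $C^\infty$ vector field on $\mathcal M$ whose flow $(\phi_t)_{t\in\mathbb R}$ preserves $\omega$, and let $\mathcal M_*=\{x : X(x)=0\}$ be its set of fixed points. A \emph{stable} (resp. \emph{unstable}) \emph{separatrix} is a trajectory $\phi_{\mathbb R}(x)$, $x\notin\mathcal M_*$, such that $\phi_t(x)$ converges to a fixed point as $t\to+\infty$ (resp. $t\to-\infty$). Assume that $(\phi_t)$ has finitely many (possibly zero) fixed points and finitely many separatrices. A \emph{local Hamiltonian} is a smooth real function $H$ on an open set with $dH=\omega(X,\cdot)$ there. A fixed point is a \emph{saddle} if a local Hamiltonian near it has neither a local maximum nor a local minimum at it. A \emph{separatrix path} is a set that is the union of: saddles $s_1,\dots,s_N$ with $N\ge 1$ (not necessarily distinct); a piece $\phi_{[0,\infty)}(a)$, where either $a=s_1$, or $a\notin\mathcal M_*$ and $\phi_t(a)\to s_1$ as $t\to+\infty$; for each $1\le i<N$ a trajectory $\phi_{\mathbb R}(c_i)$, $c_i\notin\mathcal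 M_*$, with $\phi_t(c_i)\to s_i$ as $t\to-\infty$ and $\phi_t(c_i)\to s_{i+1}$ as $t\to+\infty$; and a piece $\phi_{(-\infty,0]}(b)$, where either $b=s_N$, or $b\notin\mathcal M_*$ and $\phi_t(b)\to s_N$ as $t\to-\infty$. Let $(\psi_s)$ be the orthogonal flow: the (in general incomplete) flow on $\mathcal M\setminus\mathcal M_*$ of the unique vector field $Y$ on $\mathcal M\setminus\mathcal M_*$ that is orthogonal to $X$ and satisfies $\omega(X,Y)=1$. Let $x_0\in\mathcal M\setminus\mathcal M_*$, $T>0$ and $\gamma=\phi_{[0,T]}(x_0)$. Then either $\psi_s(\gamma)\subset\mathcal M\setminus\mathcal M_*$ is defined for all $s>0$, or there exists $s_*>0$ such that $\psi_s(\gamma)\subset\mathcal M\setminus\mathcal M_*$ is defined for all $s\in[0,s_*)$ and the limit $\lim_{s\to s_*^-}\psi_s(\gamma)$ with respect to the Hausdorff distance exists and is either a separatrix path of $(\phi_t)$ or a single fixed point. -/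

import Mathlib

open Set Filter Topology Manifold
open scoped ContDiff Bundle

noncomputable section

namespace SurfaceFlow

section AreaForms

variable (M : Type*) [TopologicalSpace M] [ChartedSpace (EuclideanSpace ℝ (Fin 2)) M]
  [IsManifold (𝓡 2) ∞ M]

/-- A smooth nondegenerate area form (symplectic form) on a surface: a smooth section of the bundle
of bilinear forms on the tangent bundle which is alternating and nondegenerate at every point. -/
structure AreaForm where
  form (x : M) : TangentSpace (𝓡 2) x →L[ℝ] TangentSpace (𝓡 2) x →L[ℝ] ℝ
  alternating (x : M) (v : TangentSpace (𝓡 2) x) : form x v v = 0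
  nondegenerate (x : M) (u : TangentSpace (𝓡 2) x) : (∀ v, form x u v = 0) → u = 0
  contMDiff : ContMDiff (𝓡 2)
    ((𝓡 2).prod 𝓘(ℝ, EuclideanSpace ℝ (Fin 2) →L[ℝ] EuclideanSpace ℝ (Fin 2) →L[ℝ] ℝ)) ∞
    (fun x ↦ Bundle.TotalSpace.mk'
      (EuclideanSpace ℝ (Fin 2) →L[ℝ] EuclideanSpace ℝ (Fin 2) →L[ℝ] ℝ) x (form x))

end AreaForms

section Flows

variable {M : Type*} [TopologicalSpace M] [ChartedSpace (EuclideanSpace ℝ (Fin 2)) M]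
  [IsManifold (𝓡 2) ∞ M]

/-- The vector field `X` is smooth. -/
def IsSmoothField (X : (x : M) → TangentSpace (𝓡 2) x) : Prop :=
  ContMDiff (𝓡 2) (𝓡 2).tangent ∞ (fun x ↦ (⟨x, X x⟩ : TangentBundle (𝓡 2) M))

/-- `φ` is the smooth flow of the vector field `X`. -/
structure IsSmoothFlowOf (φ : Flow ℝ M) (X : (x : M) → TangentSpace (𝓡 2) x) : Prop where
  contMDiff : ContMDiff (𝓘(ℝ, ℝ).prod (𝓡 2)) (𝓡 2) ∞ (fun p : ℝ × M ↦ φ p.1 p.2)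
  isMIntegralCurve (x : M) : IsMIntegralCurve (I := 𝓡 2) (fun t : ℝ ↦ φ t x) X

/-- Each time-`t` map of `φ` pulls the area form back to itself. -/
def PreservesArea (φ : Flow ℝ M) (Ω : AreaForm M) : Prop :=
  ∀ (t : ℝ) (x : M) (u v : TangentSpace (𝓡 2) x),
    Ω.form (φ t x) (mfderiv (𝓡 2) (𝓡 2) (fun y ↦ φ t y) x u)
      (mfderiv (𝓡 2) (𝓡 2) (fun y ↦ φ t y) x v) = Ω.form x u v

/-- The set `M_*` of fixed points, i.e. zeroes of the vector field. -/
def fixedPts (X : (x : M) → TangentSpace (𝓡 2) x) : Set M := {x | X x = 0}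

/-- `σ` is a stable separatrix: the trajectory of a non-fixed point
that converges to a fixed point in forward time. -/
def IsStableSeparatrix (φ : Flow ℝ M) (X : (x : M) → TangentSpace (𝓡 2) x) (σ : Set M) : Prop :=
  ∃ x ∉ fixedPts X, σ = range (fun t : ℝ ↦ φ t x) ∧
    ∃ p ∈ fixedPts X, Tendsto (fun t : ℝ ↦ φ t x) atTop (𝓝 p)

/-- `σ` is an unstable separatrix: the trajectory of a non-fixed point
that converges to a fixed point in backward time. -/
def IsUnstableSeparatrix (φ : Flow ℝ M) (X : (x : M) → TangentSpace (𝓡 2) x) (σ : Set M) : Prop :=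
  ∃ x ∉ fixedPts X, σ = range (fun t : ℝ ↦ φ t x) ∧
    ∃ p ∈ fixedPts X, Tendsto (fun t : ℝ ↦ φ t x) atBot (𝓝 p)

/-- `H` is a local Hamiltonian on the open set `U`: it is smooth there and `dH = Ω(X, ·)`. -/
structure IsLocalHamiltonian (Ω : AreaForm M) (X : (x : M) → TangentSpace (𝓡 2) x)
    (U : Set M) (H : M → ℝ) : Prop where
  isOpen : IsOpen U
  contMDiffOn : ContMDiffOn (𝓡 2) 𝓘(ℝ, ℝ) ∞ H U
  mfderiv_eq : ∀ x ∈ U, ∀ v : TangentSpace (𝓡 2) x,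
    mfderiv (𝓡 2) 𝓘(ℝ, ℝ) H x v = Ω.form x (X x) v

/-- A saddle (possibly degenerate): a fixed point at which the local Hamiltonian, which is unique
near the point up to an additive constant, attains neither a local maximum nor a local minimum. -/
def IsSaddle (Ω : AreaForm M) (X : (x : M) → TangentSpace (𝓡 2) x) (p : M) : Prop :=
  p ∈ fixedPts X ∧
    ∃ (U : Set M) (H : M → ℝ), p ∈ U ∧ IsLocalHamiltonian Ω X U H ∧ ¬ IsLocalExtr H p

/-- The trajectory segment `φ_{[0,T]}(x₀)`. -/
def trajSegment (φ : Flow ℝ M) (x₀ : M) (T : ℝ) : Set M := (fun t : ℝ ↦ φ t x₀) '' Icc 0 T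

/-- A separatrix path: the union of a beginning point `a`, saddles `S 0, …, S n` (at least one), an
ending point `b`, a stable separatrix piece from `a` to `S 0` (or `a = S 0`), separatrix connections
from `S i` to `S (i + 1)` (the trajectory of a non-fixed point `c i`), and an unstable separatrix
piece from `S n` to `b` (or `b = S n`). -/
def IsSeparatrixPath (φ : Flow ℝ M) (Ω : AreaForm M) (X : (x : M) → TangentSpace (𝓡 2) x)
    (L : Set M) : Prop :=
  ∃ (n : ℕ) (a b : M) (S : Fin (n + 1) → M) (c : Fin n → M),
    (∀ i, IsSaddle Ω X (S i)) ∧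
    (a = S 0 ∨ (a ∉ fixedPts X ∧ Tendsto (fun t : ℝ ↦ φ t a) atTop (𝓝 (S 0)))) ∧
    (∀ i : Fin n, c i ∉ fixedPts X ∧
      Tendsto (fun t : ℝ ↦ φ t (c i)) atBot (𝓝 (S i.castSucc)) ∧
      Tendsto (fun t : ℝ ↦ φ t (c i)) atTop (𝓝 (S i.succ))) ∧
    (b = S (Fin.last n) ∨
      (b ∉ fixedPts X ∧ Tendsto (fun t : ℝ ↦ φ t b) atBot (𝓝 (S (Fin.last n))))) ∧
    L = (fun t : ℝ ↦ φ t a) '' Ici 0 ∪ range S ∪ (⋃ i, range (fun t : ℝ ↦ φ t (c i))) ∪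
      (fun t : ℝ ↦ φ t b) '' Iic 0

end Flows

section Orthogonal

variable {M : Type*} [EMetricSpace M] [ChartedSpace (EuclideanSpace ℝ (Fin 2)) M]
  [IsManifold (𝓡 2) ∞ M] [Bundle.RiemannianBundle (fun x : M ↦ TangentSpace (𝓡 2) x)]

/-- The Riemannian metric is consistent with the area form: orthonormal frames have area `±1`. -/
def IsConsistentMetric (Ω : AreaForm M) : Prop :=
  ∀ (x : M) (u v : TangentSpace (𝓡 2) x), ‖u‖ = 1 → ‖v‖ = 1 → inner ℝ u v = 0 →
    |Ω.form x u v| = 1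

instance instFiniteDimensionalTangent (x : M) : FiniteDimensional ℝ (TangentSpace (𝓡 2) x) :=
  inferInstanceAs (FiniteDimensional ℝ (EuclideanSpace ℝ (Fin 2)))

instance instCompleteTangent (x : M) : CompleteSpace (TangentSpace (𝓡 2) x) :=
  FiniteDimensional.complete ℝ _

/-- The gradient of the local Hamiltonian: the Riesz representative of `dH = Ω(X, ·)`. -/
def hamGradient (Ω : AreaForm M) (X : (x : M) → TangentSpace (𝓡 2) x) (x : M) :
    TangentSpace (𝓡 2) x :=
  (InnerProductSpace.toDual ℝ (TangentSpace (𝓡 2) x)).symm (Ω.form x (X x))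

/-- The field `Y` generating the orthogonal flow on `M \ M_*`, namely `∇H / |∇H|²`; it is the unique
field with `Y ⟂ X` and `Ω(X, Y) = 1` (see the lemmas below). Its value on `M_*` is never used. -/
def orthField (Ω : AreaForm M) (X : (x : M) → TangentSpace (𝓡 2) x) (x : M) :
    TangentSpace (𝓡 2) x :=
  (‖hamGradient Ω X x‖ ^ 2)⁻¹ • hamGradient Ω X x

theorem inner_hamGradient (Ω : AreaForm M) (X : (x : M) → TangentSpace (𝓡 2) x) (x : M)
    (v : TangentSpace (𝓡 2) x) : inner ℝ (hamGradient Ω X x) v = Ω.form x (X x) v := by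
  exact InnerProductSpace.toDual_symm_apply

theorem orthField_orthogonal (Ω : AreaForm M) (X : (x : M) → TangentSpace (𝓡 2) x) (x : M) :
    inner ℝ (X x) (orthField Ω X x) = 0 := by
  rw [orthField, inner_smul_right, real_inner_comm, inner_hamGradient, Ω.alternating, mul_zero]

theorem form_orthField (Ω : AreaForm M) (X : (x : M) → TangentSpace (𝓡 2) x) (x : M)
    (hx : x ∉ fixedPts X) : Ω.form x (X x) (orthField Ω X x) = 1 := by
  have hG : hamGradient Ω X x ≠ 0 := by
    intro h
    apply hx
    apply Ω.nondegenerate x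
    intro v
    rw [← inner_hamGradient, h, inner_zero_left]
  rw [← inner_hamGradient, orthField, inner_smul_right, real_inner_self_eq_norm_sq]
  exact inv_mul_cancel₀ (by positivity)

theorem eq_orthField (Ω : AreaForm M) (X : (x : M) → TangentSpace (𝓡 2) x) (x : M)
    (hx : x ∉ fixedPts X) (v : TangentSpace (𝓡 2) x) (h0 : inner ℝ (X x) v = 0)
    (h1 : Ω.form x (X x) v = 1) : v = orthField Ω X x := by
  by_contra hne
  have hw0 : v - orthField Ω X x ≠ 0 := sub_ne_zero.2 hne
  have hXw : inner ℝ (X x) (v - orthField Ω X x) = 0 := by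
    rw [inner_sub_right, h0, orthField_orthogonal, sub_zero]
  have hGw : inner ℝ (hamGradient Ω X x) (v - orthField Ω X x) = 0 := by
    rw [inner_hamGradient, map_sub, h1, form_orthField Ω X x hx, sub_self]
  have hGX : inner ℝ (hamGradient Ω X x) (X x) = 0 := by
    rw [inner_hamGradient, Ω.alternating]
  have hG : hamGradient Ω X x ≠ 0 := by
    intro h
    apply hx
    apply Ω.nondegenerate x
    intro v
    rw [← inner_hamGradient, h, inner_zero_left]
  have hli : LinearIndependent ℝ ![hamGradient Ω X x, X x, v - orthField Ω X x] := by
    apply linearIndependent_of_ne_zero_of_inner_eq_zero (𝕜 := ℝ)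
    · intro i
      fin_cases i
      · exact hG
      · exact hx
      · exact hw0
    · intro i j hij
      fin_cases i <;> fin_cases j <;>
        first
        | exact absurd rfl hij
        | assumption
        | (rw [real_inner_comm]; assumption)
  have hc := hli.fintype_card_le_finrank
  have hd : Module.finrank ℝ (TangentSpace (𝓡 2) x) = 2 :=
    finrank_euclideanSpace_fin (𝕜 := ℝ) (n := 2)
  rw [hd] at hc
  simp at hc

/-- `ψ_s(p)` is defined and equals `q` (for `s ≥ 0`): the integral curve of `Y` that starts at `p`
stays in `M \ M_*` during `[0,s]` and is at `q` at time `s`. -/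
def OrthFlowTo (Ω : AreaForm M) (X : (x : M) → TangentSpace (𝓡 2) x) (s : ℝ) (p q : M) : Prop :=
  ∃ β : ℝ → M, β 0 = p ∧ β s = q ∧ (∀ r ∈ Icc 0 s, β r ∉ fixedPts X) ∧
    IsMIntegralCurveOn (I := 𝓡 2) β (orthField Ω X) (Icc 0 s)

/-- `ψ_s` is defined at all points of `A`. -/
def OrthDefinedOn (Ω : AreaForm M) (X : (x : M) → TangentSpace (𝓡 2) x) (s : ℝ) (A : Set M) :
    Prop :=
  ∀ p ∈ A, ∃ q, OrthFlowTo Ω X s p q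

/-- The image `ψ_s(A)`. -/
def orthImage (Ω : AreaForm M) (X : (x : M) → TangentSpace (𝓡 2) x) (s : ℝ) (A : Set M) : Set M :=
  {q | ∃ p ∈ A, OrthFlowTo Ω X s p q}

end Orthogonal

end SurfaceFlow

end

/-! Write `Y` for `orthField Ω X`. Since `φ` preserves both `X` and the area form, the image of `Y`
under the differential of `φ τ` still has area `1` with `X`, so it differs from `Y` only by a
multiple of `X` (`orthField_flow`). Hence, near one orthogonal trajectory `β`, the others are `φ (θ
s) (β s)`, where `θ` solves a scalar equation with equilibrium `0` (`exists_strip`). The orthogonal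
flow therefore carries pieces of trajectories to pieces of trajectories, continuously and preserving
their order. The strip also shows that the set of times at which the flow is defined on the whole
segment is open to the right, so in the second alternative there is a first bad time `S`
(`exists_maximal_time`).

The field `Y` blows up at the fixed points, but a bump function that is constant near each fixed
point has a bounded derivative along `Y`. So orthogonal trajectories need a minimal time to leave a
neighbourhood of any point (`exists_nhds_barrier`). Consequently each of them has a limit `g t` as
`s` tends to `S`, and the convergence is joint in `s` and `t`. The limit path `g` is continuous and
its image is the Hausdorff limit.

Where `g t` is not fixed, the orthogonal flow still exists at time `S`, and the strip shows that `g`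
runs forward along a trajectory (`isLocallyArc_limit`). Some `g t` is fixed, as otherwise `S` would
not be a bad time. Between two successive visits to the fixed points, `g` runs through a whole
trajectory connecting them (`gap_trajectory`). There are finitely many separatrices, so one point
chosen on each gives a finite set that every such excursion meets; by compactness the excursions
have a minimal duration, so there are finitely many. Together with the pieces before the first visit
and after the last one they form a separatrix path, or else `g` is constant
(`isSeparatrixPath_or_singleton`).

The fixed points met this way are saddles: a local Hamiltonian is constant along a trajectory
converging to such a point, so an extremum there would be an extremum at non-fixed points as well
(`isSaddle_of_tendsto_aux`). Local Hamiltonians exist because area preservation makes the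
contraction of the area form with `X` closed (`exists_localHamiltonian`). -/

namespace SurfaceFlow

/-! ### Smoothness of the orthogonal field. -/

section OrthSmooth

variable {M : Type*} [EMetricSpace M] [ChartedSpace (EuclideanSpace ℝ (Fin 2)) M]
  [IsManifold (𝓡 2) ∞ M] [Bundle.RiemannianBundle (fun x : M ↦ TangentSpace (𝓡 2) x)]
  [IsContMDiffRiemannianBundle (𝓡 2) ∞ (EuclideanSpace ℝ (Fin 2))
      (fun x : M ↦ TangentSpace (𝓡 2) x)]
  {Ω : AreaForm M} {X : (x : M) → TangentSpace (𝓡 2) x}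

theorem contMDiffAt_form_apply (Ω : AreaForm M) {U V : (x : M) → TangentSpace (𝓡 2) x} {p : M}
    (hU : ContMDiffAt (𝓡 2) (𝓡 2).tangent ∞ (fun x ↦ (⟨x, U x⟩ : TangentBundle (𝓡 2) M)) p)
    (hV : ContMDiffAt (𝓡 2) (𝓡 2).tangent ∞ (fun x ↦ (⟨x, V x⟩ : TangentBundle (𝓡 2) M)) p) :
    ContMDiffAt (𝓡 2) 𝓘(ℝ, ℝ) ∞ (fun x ↦ Ω.form x (U x) (V x)) p := by
  have h := ContMDiffAt.clm_bundle_apply₂ (IB := 𝓡 2) (E₃ := fun _ : M ↦ ℝ) (F₃ := ℝ)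
    (b := fun x : M ↦ x) (Ω.contMDiff p) hU hV
  rw [Bundle.contMDiffAt_totalSpace] at h
  simpa using h.2

/-- Gram–Schmidt: extend a vector `v` with `Ω(X, v) ≠ 0` to a local section, remove its component
along `X` and normalise the area. By `eq_orthField` this smooth expression is the orthogonal field
near `p`. -/
theorem contMDiffAt_orthField (hX : IsSmoothField X) {p : M} (hp : p ∉ fixedPts X) :
    ContMDiffAt (𝓡 2) (𝓡 2).tangent ∞
      (fun x ↦ (⟨x, orthField Ω X x⟩ : TangentBundle (𝓡 2) M)) p := by
  obtain ⟨v, hv⟩ : ∃ v, Ω.form p (X p) v ≠ 0 := by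
    by_contra! h
    exact hp (Ω.nondegenerate p _ h)
  set V : (x : M) → TangentSpace (𝓡 2) x :=
    FiberBundle.extend (EuclideanSpace ℝ (Fin 2)) v with hVdef
  have hV : ContMDiffAt (𝓡 2) (𝓡 2).tangent ∞
      (fun x ↦ (⟨x, V x⟩ : TangentBundle (𝓡 2) M)) p :=
    FiberBundle.contMDiffAt_extend (𝓡 2) (EuclideanSpace ℝ (Fin 2)) v
  have hVp : V p = v := by simp [hVdef]
  have hf := contMDiffAt_form_apply Ω (hX p) hV
  have hXV : ContMDiffAt (𝓡 2) 𝓘(ℝ, ℝ) ∞ (fun x ↦ inner ℝ (X x) (V x)) p :=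
    ContMDiffAt.inner_bundle (b := fun x : M ↦ x) (hX p) hV
  have hXX : ContMDiffAt (𝓡 2) 𝓘(ℝ, ℝ) ∞ (fun x ↦ inner ℝ (X x) (X x)) p :=
    ContMDiffAt.inner_bundle (b := fun x : M ↦ x) (hX p) (hX p)
  have hXp : inner ℝ (X p) (X p) ≠ 0 := by
    rw [inner_self_ne_zero]; exact hp
  have hne : ∀ᶠ x in 𝓝 p, Ω.form x (X x) (V x) ≠ 0 :=
    hf.continuousAt.eventually_ne (by rw [hVp]; exact hv)
  have hreg : ∀ᶠ x in 𝓝 p, inner ℝ (X x) (X x) ≠ 0 := hXX.continuousAt.eventually_ne hXp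
  have hsec : ContMDiffAt (𝓡 2) (𝓡 2).tangent ∞
      (fun x ↦ (⟨x, (Ω.form x (X x) (V x))⁻¹ •
        (V x - (inner ℝ (X x) (V x) * (inner ℝ (X x) (X x))⁻¹) • X x)⟩ :
          TangentBundle (𝓡 2) M)) p := by
    refine ContMDiffAt.smul_section (hf.inv₀ (by rw [hVp]; exact hv)) ?_
    exact hV.sub_section ((hXV.mul (hXX.inv₀ hXp)).smul_section (hX p))
  refine hsec.congr_of_eventuallyEq ?_
  filter_upwards [hne, hreg] with x hx hx'
  have hxf : x ∉ fixedPts X := fun h ↦ hx' (by rw [show X x = 0 from h, inner_zero_left])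
  congr 1
  refine (eq_orthField Ω X x hxf _ ?_ ?_).symm
  · rw [inner_smul_right, inner_sub_right, inner_smul_right]
    field_simp
    ring
  · rw [map_smul, map_sub, map_smul, Ω.alternating]
    simp [hx]

end OrthSmooth

/-! ### Integral curves on closed intervals: uniqueness, extension, regularity. -/

section IntegralCurves

variable {M : Type*} [TopologicalSpace M] [ChartedSpace (EuclideanSpace ℝ (Fin 2)) M]
  [IsManifold (𝓡 2) ∞ M] {v : (x : M) → TangentSpace (𝓡 2) x}

/-- The vector field is continuously differentiable at a point. -/
def IsC1At (v : (x : M) → TangentSpace (𝓡 2) x) (p : M) : Prop :=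
  ContMDiffAt (𝓡 2) (𝓡 2).tangent 1 (fun x ↦ (⟨x, v x⟩ : TangentBundle (𝓡 2) M)) p

/-- The vector field read in the preferred chart at `q`. -/
noncomputable def chartField (v : (x : M) → TangentSpace (𝓡 2) x) (q : M) (z : EuclideanSpace ℝ (Fin 2)) :
    EuclideanSpace ℝ (Fin 2) :=
  tangentCoordChange (𝓡 2) ((extChartAt (𝓡 2) q).symm z) q ((extChartAt (𝓡 2) q).symm z)
    (v ((extChartAt (𝓡 2) q).symm z))

theorem IsC1At.contDiffAt_chartField {q : M} (hv : IsC1At v q) :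
    ContDiffAt ℝ 1 (chartField v q) (extChartAt (𝓡 2) q q) := by
  have hv : ContMDiffAt (𝓡 2) (𝓡 2).tangent 1
    (fun x ↦ (⟨x, v x⟩ : TangentBundle (𝓡 2) M)) q := hv
  rw [contMDiffAt_iff] at hv
  exact (hv.2.contDiffAt (range_mem_nhds_isInteriorPoint
    BoundarylessManifold.isInteriorPoint)).snd

theorem hasDerivWithinAt_chartField {γ : ℝ → M} {s : Set ℝ} {t t₀ : ℝ} {q : M}
    (hγ : IsMIntegralCurveOn γ v s) (ht : t ∈ s) (hq : γ t₀ = q)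
    (hsrc : γ t ∈ (extChartAt (𝓡 2) q).source) :
    HasDerivWithinAt (fun t ↦ extChartAt (𝓡 2) q (γ t))
      (chartField v q (extChartAt (𝓡 2) q (γ t))) s t := by
  subst hq
  have h := hγ.hasDerivWithinAt ht hsrc
  rw [chartField, PartialEquiv.left_inv _ hsrc]
  exact h

theorem isMIntegralCurveOn_congr {γ γ' : ℝ → M} {s : Set ℝ} (h : IsMIntegralCurveOn γ v s)
    (he : EqOn γ' γ s) : IsMIntegralCurveOn γ' v s := by
  intro t ht
  have h1 := (h t ht).congr_of_eventuallyEq (f₁ := γ') (he.eventuallyEq_nhdsWithin) (he ht)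
  convert h1 using 1
  rw [he ht]

/-- For a short time both curves stay in one chart and in a set where the field read there is
Lipschitz, so uniqueness in the plane applies. Everything is one-sided because the curves are only
controlled on `Icc a b`. -/
theorem exists_eqOn_Icc_of_isC1At {γ γ' : ℝ → M} {a b : ℝ} (hab : a < b)
    (hγ : IsMIntegralCurveOn γ v (Icc a b)) (hγ' : IsMIntegralCurveOn γ' v (Icc a b))
    (h : γ a = γ' a) (hv : IsC1At v (γ a)) : ∃ c ∈ Ioc a b, EqOn γ γ' (Icc a c) := by
  obtain ⟨K, s, hs, hlip⟩ := hv.contDiffAt_chartField.exists_lipschitzOnWith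
  have key : ∀ g : ℝ → M, IsMIntegralCurveOn g v (Icc a b) → g a = γ a →
      ∀ᶠ t in 𝓝[≥] a, g t ∈ (extChartAt (𝓡 2) (γ a)).source ∧ extChartAt (𝓡 2) (γ a) (g t) ∈ s := by
    intro g hg hga
    have hc : ContinuousWithinAt g (Ici a) a :=
      (hg.continuousWithinAt (left_mem_Icc.2 hab.le)).mono_of_mem_nhdsWithin
        (Icc_mem_nhdsGE hab)
    refine (hc.tendsto.eventually (hga ▸ extChartAt_source_mem_nhds (I := 𝓡 2) (γ a))).and ?_
    refine hc.tendsto.eventually ((continuousAt_extChartAt (I := 𝓡 2) (γ a)).eventually ?_ |>.filter_mono ?_)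
    · exact hs
    · rw [hga]
  obtain ⟨c, hc, hsub⟩ := (mem_nhdsGE_iff_exists_Icc_subset).1 ((key γ hγ rfl).and (key γ' hγ' h.symm))
  refine ⟨min c b, ⟨lt_min hc hab, min_le_right _ _⟩, ?_⟩
  have hsub' : ∀ t ∈ Icc a (min c b), t ∈ Icc a b ∧ t ∈ Icc a c := fun t ht ↦
    ⟨⟨ht.1, ht.2.trans (min_le_right _ _)⟩, ⟨ht.1, ht.2.trans (min_le_left _ _)⟩⟩
  have hder : ∀ g : ℝ → M, IsMIntegralCurveOn g v (Icc a b) → g a = γ a →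
      (∀ t ∈ Icc a c, g t ∈ (extChartAt (𝓡 2) (γ a)).source) →
      (∀ t ∈ Icc a (min c b), HasDerivWithinAt (fun t ↦ extChartAt (𝓡 2) (γ a) (g t))
        (chartField v (γ a) (extChartAt (𝓡 2) (γ a) (g t))) (Icc a b) t) := fun g hg hga hgs t ht ↦
    hasDerivWithinAt_chartField hg (hsub' t ht).1 hga (hgs t (hsub' t ht).2)
  have hd1 := hder γ hγ rfl (fun t ht ↦ (hsub ht).1.1)
  have hd2 := hder γ' hγ' h.symm (fun t ht ↦ (hsub ht).2.1)
  have hico : ∀ t ∈ Ico a (min c b), t ∈ Icc a (min c b) := fun t ht ↦ ⟨ht.1, ht.2.le⟩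
  have hmem : ∀ t ∈ Ico a (min c b), Icc a b ∈ 𝓝[≥] t := fun t ht ↦
    mem_of_superset (Icc_mem_nhdsGE (ht.2.trans_le (min_le_right _ _))) (Icc_subset_Icc_left ht.1)
  have heq := ODE_solution_unique_of_mem_Icc_right (s := fun _ ↦ s) (v := fun _ ↦ chartField v (γ a))
    (K := K) (fun _ _ ↦ hlip)
    (fun t ht ↦ ((hd1 t ht).continuousWithinAt).mono (fun t ht ↦ (hsub' t ht).1))
    (fun t ht ↦ (hd1 t (hico t ht)).mono_of_mem_nhdsWithin (hmem t ht))
    (fun t ht ↦ (hsub (hsub' t (hico t ht)).2).1.2)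
    (fun t ht ↦ ((hd2 t ht).continuousWithinAt).mono (fun t ht ↦ (hsub' t ht).1))
    (fun t ht ↦ (hd2 t (hico t ht)).mono_of_mem_nhdsWithin (hmem t ht))
    (fun t ht ↦ (hsub (hsub' t (hico t ht)).2).2.2) (by simp [h])
  intro t ht
  exact (extChartAt (𝓡 2) (γ a)).injOn (hsub (hsub' t ht).2).1.1 (hsub (hsub' t ht).2).2.1 (heq ht)

/-- Integral curves with the same initial point agree. -/
theorem eqOn_Icc_of_isC1At [T2Space M] {γ γ' : ℝ → M} {a b : ℝ}
    (hγ : IsMIntegralCurveOn γ v (Icc a b)) (hγ' : IsMIntegralCurveOn γ' v (Icc a b))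
    (h : γ a = γ' a) (hv : ∀ t ∈ Icc a b, IsC1At v (γ t)) : EqOn γ γ' (Icc a b) := by
  have hcl : IsClosed ({t | γ t = γ' t} ∩ Icc a b) := by
    rw [isClosed_iff_clusterPt]
    intro t ht
    have htI : t ∈ Icc a b := isClosed_Icc.closure_subset_iff.2 inter_subset_right
      (mem_closure_iff_clusterPt.2 ht)
    refine ⟨?_, htI⟩
    have hne : (𝓝[{t | γ t = γ' t} ∩ Icc a b] t).NeBot := ht
    refine tendsto_nhds_unique_of_eventuallyEq (l := 𝓝[{t | γ t = γ' t} ∩ Icc a b] t)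
      ((hγ.continuousOn t htI).mono inter_subset_right).tendsto
      ((hγ'.continuousOn t htI).mono inter_subset_right).tendsto ?_
    filter_upwards [self_mem_nhdsWithin] with u hu using hu.1
  refine hcl.Icc_subset_of_forall_exists_gt h ?_
  rintro x ⟨hx, hxa, hxb⟩ y hy
  obtain ⟨c, hc, he⟩ := exists_eqOn_Icc_of_isC1At (v := v) hxb
    (hγ.mono (Icc_subset_Icc_left hxa)) (hγ'.mono (Icc_subset_Icc_left hxa)) hx (hv x ⟨hxa, hxb.le⟩)
  exact ⟨min c y, he ⟨le_min hc.1.le (le_of_lt hy), min_le_left _ _⟩, lt_min hc.1 hy, min_le_right _ _⟩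

theorem isMIntegralCurveOn_ite {γ α : ℝ → M} {a b c : ℝ} (hab : a ≤ b) (hbc : b ≤ c)
    (hγ : IsMIntegralCurveOn γ v (Icc a b)) (hα : IsMIntegralCurveOn α v (Icc b c))
    (h : γ b = α b) : IsMIntegralCurveOn (fun t ↦ if t ≤ b then γ t else α t) v (Icc a c) := by
  set δ : ℝ → M := fun t ↦ if t ≤ b then γ t else α t with hδ
  have h1 : IsMIntegralCurveOn δ v (Icc a b) :=
    isMIntegralCurveOn_congr hγ fun t ht ↦ by simp [hδ, ht.2]
  have h2 : IsMIntegralCurveOn δ v (Icc b c) := isMIntegralCurveOn_congr hα fun t ht ↦ by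
    rcases eq_or_lt_of_le ht.1 with rfl | hlt
    · simp [hδ, h]
    · simp [hδ, not_le.2 hlt]
  intro t ht
  rcases lt_trichotomy t b with hlt | rfl | hlt
  · refine (h1 t ⟨ht.1, hlt.le⟩).mono_of_mem_nhdsWithin ?_
    filter_upwards [self_mem_nhdsWithin, nhdsWithin_le_nhds (Iio_mem_nhds hlt)] with u hu hu'
    exact ⟨hu.1, le_of_lt hu'⟩
  · rw [← Icc_union_Icc_eq_Icc hab hbc]
    exact (h1 t ⟨hab, le_rfl⟩).union (h2 t ⟨le_rfl, hbc⟩)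
  · refine (h2 t ⟨hlt.le, ht.2⟩).mono_of_mem_nhdsWithin ?_
    filter_upwards [self_mem_nhdsWithin, nhdsWithin_le_nhds (Ioi_mem_nhds hlt)] with u hu hu'
    exact ⟨le_of_lt hu', hu.2⟩

/-- An integral curve can be continued to the right. -/
theorem exists_extension_of_isC1At {γ : ℝ → M} {a b : ℝ} (hab : a ≤ b)
    (hγ : IsMIntegralCurveOn γ v (Icc a b)) (hv : IsC1At v (γ b)) :
    ∃ ε > 0, ∃ γ' : ℝ → M, EqOn γ' γ (Icc a b) ∧ IsMIntegralCurveOn γ' v (Icc a (b + ε)) := by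
  obtain ⟨α, hα, hαv⟩ := exists_isMIntegralCurveAt_of_contMDiffAt_boundaryless b hv
  rw [isMIntegralCurveAt_iff'] at hαv
  obtain ⟨ε, hε, hα'⟩ := hαv
  refine ⟨ε / 2, by positivity, _, fun t ht ↦ ?_, isMIntegralCurveOn_ite hab (by linarith) hγ
    (hα'.mono fun t ht ↦ ?_) hα.symm⟩
  · simp [ht.2]
  · rw [Metric.mem_ball, Real.dist_eq, abs_lt]
    constructor <;> linarith [ht.1, ht.2]

/-- An integral curve on a half-open interval that has a limit is an integral curve on the closed
interval. -/
theorem isMIntegralCurveOn_update {γ : ℝ → M} {a b : ℝ} {q : M} (hab : a < b)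
    (hγ : IsMIntegralCurveOn γ v (Ico a b)) (hq : Tendsto γ (𝓝[<] b) (𝓝 q)) (hv : IsC1At v q) :
    IsMIntegralCurveOn (Function.update γ b q) v (Icc a b) := by
  set δ := Function.update γ b q with hδ
  have hδb : δ b = q := by simp [hδ]
  have hδt : ∀ t, t ≠ b → δ t = γ t := fun t ht ↦ by simp [hδ, ht]
  have h1 : IsMIntegralCurveOn δ v (Ico a b) :=
    isMIntegralCurveOn_congr hγ fun t ht ↦ hδt t ht.2.ne
  have hlim : Tendsto δ (𝓝[<] b) (𝓝 q) := hq.congr' <| by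
    filter_upwards [self_mem_nhdsWithin] with t ht using (hδt t (ne_of_lt ht)).symm
  have hcont : ContinuousWithinAt δ (Icc a b) b := by
    have : ContinuousWithinAt δ (Iic b) b := by
      rw [← continuousWithinAt_Iio_iff_Iic]
      simpa [ContinuousWithinAt, hδb] using hlim
    exact this.mono fun t ht ↦ ht.2
  intro t ht
  rcases eq_or_lt_of_le ht.2 with rfl | hlt
  · have hsrc : ∀ᶠ u in 𝓝[<] t, δ u ∈ (extChartAt (𝓡 2) q).source :=
      hlim.eventually (extChartAt_source_mem_nhds (I := 𝓡 2) q)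
    obtain ⟨l, hl, hsub⟩ := (mem_nhdsLT_iff_exists_Ioo_subset' hab).1
      (hsrc.and (Ioo_mem_nhdsLT hab))
    have hder : ∀ u ∈ Ioo l t, HasDerivAt (fun u ↦ extChartAt (𝓡 2) q (δ u))
        (chartField v q (extChartAt (𝓡 2) q (δ u))) u := fun u hu ↦
      (hasDerivWithinAt_chartField h1 ⟨(hsub hu).2.1.le, hu.2⟩ hδb (hsub hu).1).hasDerivAt
        (Ico_mem_nhds (hsub hu).2.1 hu.2)
    have hce : Tendsto (fun u ↦ extChartAt (𝓡 2) q (δ u)) (𝓝[<] t) (𝓝 (extChartAt (𝓡 2) q q)) :=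
      (continuousAt_extChartAt (I := 𝓡 2) q).tendsto.comp hlim
    -- The left derivative at the endpoint is the limit of the interior derivatives, which converge
    -- because the field is continuous at `q`.
    have hd := hasDerivWithinAt_Iic_of_tendsto_deriv (s := Ioo l t) (a := t)
      (f := fun u ↦ extChartAt (𝓡 2) q (δ u)) (e := chartField v q (extChartAt (𝓡 2) q q))
      (fun u hu ↦ (hder u hu).differentiableAt.differentiableWithinAt)
      (by
        have := hce.mono_left (nhdsWithin_mono t (fun u (hu : u ∈ Ioo l t) ↦ hu.2))
        simpa [ContinuousWithinAt, hδb] using this)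
      (Ioo_mem_nhdsLT hl)
      (by
        refine (hv.contDiffAt_chartField.continuousAt.tendsto.comp hce).congr' ?_
        filter_upwards [Ioo_mem_nhdsLT hl] with u hu using (hder u hu).deriv.symm)
    have hself : chartField v q (extChartAt (𝓡 2) q q) = v q := by
      rw [chartField, extChartAt_to_inv]
      exact tangentCoordChange_self (I := 𝓡 2) (mem_extChartAt_source (I := 𝓡 2) q)
    have hw : HasFDerivWithinAt (fun u ↦ extChartAt (𝓡 2) (δ t) (δ u))
        ((1 : ℝ →L[ℝ] ℝ).smulRight (v (δ t))) (Iic t) t := by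
      rw [hself] at hd
      rw [hδb]
      exact hd.hasFDerivWithinAt
    exact ⟨hcont, hw.mono fun u hu ↦ hu.1.2⟩
  · refine (h1 t ⟨ht.1, hlt⟩).mono_of_mem_nhdsWithin ?_
    filter_upwards [self_mem_nhdsWithin, nhdsWithin_le_nhds (Iio_mem_nhds hlt)] with u hu hu'
    exact ⟨hu.1, hu'⟩

/-- Bootstrapping: in a chart the derivative of the curve is the field along the curve, hence
continuous. This regularity makes the scalar equation of the strip locally Lipschitz. -/
theorem contMDiffOn_of_isMIntegralCurveOn {γ : ℝ → M} {s : Set ℝ}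
    (hγ : IsMIntegralCurveOn γ v s) (hv : ∀ t ∈ s, IsC1At v (γ t)) :
    ContMDiffOn 𝓘(ℝ, ℝ) (𝓡 2) 1 γ s := by
  intro t ht
  rw [contMDiffWithinAt_iff]
  refine ⟨hγ.continuousOn t ht, ?_⟩
  set u := s ∩ γ ⁻¹' (extChartAt (𝓡 2) (γ t)).source with hu
  have hun : u ∈ 𝓝[insert t s] t := by
    rw [insert_eq_of_mem ht]
    exact inter_mem self_mem_nhdsWithin
      ((hγ.continuousOn t ht).preimage_mem_nhdsWithin (extChartAt_source_mem_nhds (I := 𝓡 2) (γ t)))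
  have hd : ∀ r ∈ u, HasDerivWithinAt (fun r ↦ extChartAt (𝓡 2) (γ t) (γ r))
        (chartField v (γ t) (extChartAt (𝓡 2) (γ t) (γ r))) u r := fun r hr ↦
    (hasDerivWithinAt_chartField hγ hr.1 rfl hr.2).mono inter_subset_left
  have hcd : ContDiffWithinAt ℝ (0 + 1) (fun r ↦ extChartAt (𝓡 2) (γ t) (γ r)) s t := by
    rw [contDiffWithinAt_succ_iff_hasFDerivWithinAt (by simp)]
    refine ⟨u, hun, by simp, fun r ↦ (1 : ℝ →L[ℝ] ℝ).smulRight
      (chartField v (γ t) (extChartAt (𝓡 2) (γ t) (γ r))), fun r hr ↦ (hd r hr).hasFDerivWithinAt, ?_⟩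
    have hc0 : ContDiffWithinAt ℝ 0 (fun r ↦ extChartAt (𝓡 2) (γ t) (γ r)) u t :=
      (contDiffOn_zero.2 fun r hr ↦ (hd r hr).continuousWithinAt) t ⟨ht, mem_extChartAt_source (γ t)⟩
    have h0 := ((hv t ht).contDiffAt_chartField.of_le zero_le_one).comp_contDiffWithinAt t hc0
    exact contDiffWithinAt_const.smulRight h0
  exact hcd.mono fun u hu ↦ hu.1

end IntegralCurves

/-! ### Integral curves of a singular field leave neighbourhoods slowly. -/

section Barrier

variable {M : Type*} [TopologicalSpace M] [ChartedSpace (EuclideanSpace ℝ (Fin 2)) M]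
  [IsManifold (𝓡 2) ∞ M] {v : (x : M) → TangentSpace (𝓡 2) x}

/-- The derivative of a function along a vector field. -/
noncomputable def derivAlong (f : M → ℝ) (v : (x : M) → TangentSpace (𝓡 2) x) (x : M) : ℝ :=
  mfderiv (𝓡 2) 𝓘(ℝ, ℝ) f x (v x)

theorem continuousAt_derivAlong {f : M → ℝ} (hf : ContMDiff (𝓡 2) 𝓘(ℝ, ℝ) ∞ f) {p : M}
    (hv : IsC1At v p) :
    ContinuousAt (derivAlong f v) p := by
  have h1 := ContMDiff.contMDiff_tangentMap (m := 0) hf (by simp)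
  have h2 : ContinuousAt (fun x ↦ tangentMap (𝓡 2) 𝓘(ℝ, ℝ) f ⟨x, v x⟩) p :=
    h1.continuous.continuousAt.comp (ContMDiffAt.continuousAt hv)
  exact continuous_snd.continuousAt.comp
    ((tangentBundleModelSpaceHomeomorph 𝓘(ℝ, ℝ)).continuous.continuousAt.comp h2)

theorem hasDerivWithinAt_comp_curve {f : M → ℝ} (hf : ContMDiff (𝓡 2) 𝓘(ℝ, ℝ) ∞ f) {γ : ℝ → M}
    {s : Set ℝ} (hγ : IsMIntegralCurveOn γ v s) {t : ℝ} (ht : t ∈ s) :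
    HasDerivWithinAt (fun t ↦ f (γ t)) (derivAlong f v (γ t)) s t := by
  have h := ((hf (γ t)).mdifferentiableAt (by simp)).hasMFDerivAt.comp_hasMFDerivWithinAt t (hγ t ht)
  have h' : HasFDerivWithinAt (fun t ↦ f (γ t))
      ((1 : ℝ →L[ℝ] ℝ).smulRight (derivAlong f v (γ t))) s t := by
    refine HasMFDerivWithinAt.hasFDerivWithinAt (h.congr_mfderiv ?_)
    ext1
    exact (mfderiv (𝓡 2) 𝓘(ℝ, ℝ) f (γ t)).map_smul (1 : ℝ) (v (γ t))
  simpa using h'.hasDerivWithinAt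

/-- Integral curves of a vector field that is singular at finitely many points only cannot escape
quickly from a neighbourhood of a point. -/
theorem exists_nhds_barrier [CompactSpace M] [T2Space M] {Z : Set M} (hZ : Z.Finite)
    (hv : ∀ p ∉ Z, IsC1At v p) (q : M) {B : Set M} (hB : B ∈ 𝓝 q) :
    ∃ B' ∈ 𝓝 q, ∃ η > 0, ∀ (γ : ℝ → M) (a b : ℝ), IsMIntegralCurveOn γ v (Icc a b) →
      γ a ∈ B' → b - a < η → ∀ t ∈ Icc a b, γ t ∈ B := by
  have hB' : B ∩ (Z \ {q})ᶜ ∈ 𝓝 q :=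
    inter_mem hB ((hZ.subset sdiff_subset).isClosed.isOpen_compl.mem_nhds (by simp))
  -- The bump function is `1` near `q` and `0` near the other points of `Z`. Its derivative along
  -- `v` thus vanishes near `Z` however singular `v` is there, so it is continuous everywhere and
  -- bounded by compactness.
  obtain ⟨f, -, hf⟩ := (SmoothBumpFunction.nhds_basis_tsupport (I := 𝓡 2) q).mem_iff.1 hB'
  have hfs : ContMDiff (𝓡 2) 𝓘(ℝ, ℝ) ∞ f := f.contMDiff
  have hconst : ∀ (x : M) (c : ℝ), (f : M → ℝ) =ᶠ[𝓝 x] (fun _ ↦ c) →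
      ContinuousAt (derivAlong f v) x := by
    intro x c hx
    have : derivAlong f v =ᶠ[𝓝 x] fun _ ↦ 0 := by
      filter_upwards [hx.eventually_nhds] with y hy
      rw [derivAlong, Filter.EventuallyEq.mfderiv_eq hy, mfderiv_const]
      rfl
    exact continuousAt_const.congr this.symm
  have hcont : Continuous (derivAlong f v) := by
    rw [continuous_iff_continuousAt]
    intro x
    by_cases hxZ : x ∈ Z
    · by_cases hxq : x = q
      · exact hconst x 1 (hxq ▸ f.eventuallyEq_one)
      · refine hconst x 0 (notMem_tsupport_iff_eventuallyEq.1 fun h ↦ (hf h).2 ⟨hxZ, hxq⟩)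
    · exact continuousAt_derivAlong hfs (hv x hxZ)
  obtain ⟨C, hC⟩ := isCompact_univ.exists_bound_of_continuousOn hcont.continuousOn
  have hC0 : 0 ≤ C := (norm_nonneg _).trans (hC q (mem_univ _))
  -- Dropping from `1` to `0` with speed at most `C` takes longer than `1 / (C + 1)`; the added `1`
  -- covers `C = 0`.
  refine ⟨{x | f x = 1}, f.eventuallyEq_one, 1 / (C + 1), by positivity, ?_⟩
  intro γ a b hγ hγa hab t ht
  have ha : a ∈ Icc a b := ⟨le_rfl, ht.1.trans ht.2⟩
  have hL := (convex_Icc a b).norm_image_sub_le_of_norm_hasDerivWithin_le (f := fun t ↦ f (γ t))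
    (C := C) (fun r hr ↦ hasDerivWithinAt_comp_curve hfs hγ hr)
    (fun r _ ↦ hC _ (mem_univ _)) ha ht
  have hpos : f (γ t) ≠ 0 := by
    intro h0
    rw [h0, show f (γ a) = 1 from hγa, Real.norm_eq_abs, Real.norm_eq_abs,
      abs_of_nonneg (by linarith [ht.1] : 0 ≤ t - a)] at hL
    rw [lt_div_iff₀ (by positivity)] at hab
    norm_num at hL
    nlinarith [ht.1, ht.2]
  exact (hf (subset_tsupport _ hpos)).1

end Barrier

/-! ### Scalar equations with an equilibrium. -/

section ScalarODE

/-- Solutions of a scalar equation with the equilibrium `0` depend monotonically and in a Lipschitz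
way on the initial value. -/
theorem exists_scalar_flow {f : ℝ → ℝ → ℝ} {S : ℝ} (hS : 0 ≤ S) {K C : NNReal}
    (hlip : ∀ s ∈ Icc 0 S, LipschitzWith K (f s)) (hcont : ∀ x, ContinuousOn (fun s ↦ f s x) (Icc 0 S))
    (hbd : ∀ s ∈ Icc 0 S, ∀ x, ‖f s x‖ ≤ C) (h0 : ∀ s ∈ Icc 0 S, f s 0 = 0) :
    ∃ θ : ℝ → ℝ → ℝ, (∀ t, θ t 0 = t) ∧ (∀ s ∈ Icc 0 S, θ 0 s = 0) ∧
      (∀ t, ∀ s ∈ Icc 0 S, HasDerivWithinAt (θ t) (f s (θ t s)) (Icc 0 S) s) ∧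
      (∀ s ∈ Icc 0 S, Monotone fun t ↦ θ t s) ∧
      ∃ C' : ℝ, 0 ≤ C' ∧ ∀ t t' : ℝ, ∀ s ∈ Icc 0 S, |θ t s - θ t' s| ≤ C' * |t - t'| := by
  have hex : ∀ t : ℝ, ∃ α : ℝ → ℝ, α 0 = t ∧
      ∀ s ∈ Icc 0 S, HasDerivWithinAt α (f s (α s)) (Icc 0 S) s := by
    intro t
    -- The bound `C` holds on the whole line, so a ball of radius `C * S` gives existence on all of
    -- `[0, S]`.
    have hpl : IsPicardLindelof f (⟨0, left_mem_Icc.2 hS⟩ : Icc 0 S) t (C * S.toNNReal) 0 C K :=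
      { lipschitzOnWith := fun s hs ↦ (hlip s hs).lipschitzOnWith
        continuousOn := fun x _ ↦ hcont x
        norm_le := fun s hs x _ ↦ hbd s hs x
        mul_max_le := by simp [hS] }
    exact hpl.exists_eq_forall_mem_Icc_hasDerivWithinAt₀
  choose θ hθ0 hθ using hex
  have hcontθ : ∀ t, ContinuousOn (θ t) (Icc 0 S) := fun t s hs ↦ (hθ t s hs).continuousWithinAt
  have hright : ∀ t, ∀ s ∈ Ico 0 S, HasDerivWithinAt (θ t) (f s (θ t s)) (Ici s) s := fun t s hs ↦
    (hθ t s ⟨hs.1, hs.2.le⟩).mono_of_mem_nhdsWithin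
      (mem_of_superset (Icc_mem_nhdsGE hs.2) (Icc_subset_Icc_left hs.1))
  have hgron : ∀ t t' : ℝ, ∀ a ∈ Icc 0 S, ∀ s ∈ Icc a S,
      dist (θ t s) (θ t' s) ≤ dist (θ t a) (θ t' a) * Real.exp (K * (s - a)) := by
    intro t t' a ha s hs
    refine dist_le_of_trajectories_ODE_of_mem (v := f) (s := fun _ ↦ univ) (b := S)
      (fun r hr ↦ (hlip r ⟨ha.1.trans hr.1, hr.2.le⟩).lipschitzOnWith)
      ((hcontθ t).mono (Icc_subset_Icc_left ha.1)) (fun r hr ↦ hright t r ⟨ha.1.trans hr.1, hr.2⟩)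
      (fun _ _ ↦ mem_univ _)
      ((hcontθ t').mono (Icc_subset_Icc_left ha.1)) (fun r hr ↦ hright t' r ⟨ha.1.trans hr.1, hr.2⟩)
      (fun _ _ ↦ mem_univ _) le_rfl s hs
  refine ⟨θ, hθ0, fun s hs ↦ ?_, hθ, fun s hs t t' htt' ↦ ?_, Real.exp (K * S), by positivity,
    fun t t' s hs ↦ ?_⟩
  · have hz := dist_le_of_trajectories_ODE_of_mem (v := f) (s := fun _ ↦ univ) (a := 0) (b := S)
      (f := θ 0) (g := fun _ ↦ 0) (δ := 0) (K := K)
      (fun r hr ↦ (hlip r ⟨hr.1, hr.2.le⟩).lipschitzOnWith)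
      (hcontθ 0) (hright 0) (fun _ _ ↦ mem_univ _) continuousOn_const
      (fun r hr ↦ by rw [h0 r ⟨hr.1, hr.2.le⟩]; exact hasDerivWithinAt_const _ _ _)
      (fun _ _ ↦ mem_univ _) (by simp [hθ0]) s hs
    simpa using hz
  -- If two solutions exchanged their order they would have met before; Grönwall's inequality
  -- started at the meeting time, with distance `0`, makes them agree afterwards.
  · by_contra! hlt
    have hlt : θ t' s < θ t s := hlt
    have hc : ContinuousOn (fun r ↦ θ t' r - θ t r) (Icc 0 s) :=
      ((hcontθ t').sub (hcontθ t)).mono (Icc_subset_Icc_right hs.2)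
    obtain ⟨r, hr, hr0⟩ := intermediate_value_Icc' hs.1 hc
      (show (0 : ℝ) ∈ Icc _ _ from ⟨by linarith, by simpa [hθ0] using htt'⟩)
    have := hgron t t' r ⟨hr.1, hr.2.trans hs.2⟩ s ⟨hr.2, hs.2⟩
    rw [show θ t r = θ t' r by linarith [show θ t' r - θ t r = 0 from hr0], dist_self, zero_mul,
      dist_le_zero] at this
    exact hlt.ne this.symm
  · have := hgron t t' 0 (left_mem_Icc.2 hS) s hs
    rw [hθ0, hθ0, Real.dist_eq, Real.dist_eq, mul_comm] at this
    refine this.trans (mul_le_mul_of_nonneg_right (Real.exp_le_exp.2 ?_) (abs_nonneg _))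
    exact mul_le_mul_of_nonneg_left (by linarith [hs.2]) K.2

end ScalarODE

/-! ### Invariance of the fixed points and of the field. -/

section FlowBasics

variable {M : Type*} [TopologicalSpace M] [ChartedSpace (EuclideanSpace ℝ (Fin 2)) M]
  [IsManifold (𝓡 2) ∞ M] {X : (x : M) → TangentSpace (𝓡 2) x} {φ : Flow ℝ M}

theorem flow_eq_of_mem_fixedPts [T2Space M] (hX : IsSmoothField X) (hφ : IsSmoothFlowOf φ X) {p : M}
    (hp : p ∈ fixedPts X) (t : ℝ) : φ t p = p := by
  have h := isMIntegralCurve_Ioo_eq_of_contMDiff_boundaryless (t₀ := 0)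
    (ContMDiff.of_le hX (by simp)) (hφ.isMIntegralCurve p) (isMIntegralCurve_const hp)
    (φ.map_zero_apply p)
  exact congrFun h t

theorem flow_neg_apply {N : Type*} [TopologicalSpace N] (φ : Flow ℝ N) (t : ℝ) (p : N) : φ (-t) (φ t p) = p := by
  rw [← φ.map_add]; simp

theorem flow_mem_fixedPts_iff [T2Space M] (hX : IsSmoothField X) (hφ : IsSmoothFlowOf φ X) {p : M}
    {t : ℝ} : φ t p ∈ fixedPts X ↔ p ∈ fixedPts X := by
  constructor
  · intro h
    have := flow_eq_of_mem_fixedPts hX hφ h (-t)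
    rw [flow_neg_apply] at this
    rwa [this]
  · intro h
    rwa [flow_eq_of_mem_fixedPts hX hφ h]

theorem contMDiff_flow (hφ : IsSmoothFlowOf φ X) (t : ℝ) :
    ContMDiff (𝓡 2) (𝓡 2) ∞ (fun x ↦ φ t x) :=
  hφ.contMDiff.comp (contMDiff_const.prodMk contMDiff_id)

/-- Differentiate the commutation of `φ r` and `φ t` at `r = 0`. -/
theorem mfderiv_flow_field (hφ : IsSmoothFlowOf φ X) (t : ℝ) (x : M) :
    mfderiv (𝓡 2) (𝓡 2) (fun y ↦ φ t y) x (X x) = X (φ t x) := by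
  have h0 : HasMFDerivAt 𝓘(ℝ, ℝ) (𝓡 2) (fun r : ℝ ↦ φ r x) 0
      ((1 : ℝ →L[ℝ] ℝ).smulRight (X (φ 0 x))) := hφ.isMIntegralCurve x 0
  have h1 := (((contMDiff_flow hφ t) (φ 0 x)).mdifferentiableAt (by simp)).hasMFDerivAt.comp 0 h0
  have h2 : HasMFDerivAt 𝓘(ℝ, ℝ) (𝓡 2) (fun r : ℝ ↦ φ r (φ t x)) 0
      ((1 : ℝ →L[ℝ] ℝ).smulRight (X (φ 0 (φ t x)))) := hφ.isMIntegralCurve (φ t x) 0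
  have h3 : (fun r : ℝ ↦ φ r (φ t x)) = (fun y ↦ φ t y) ∘ fun r : ℝ ↦ φ r x := by
    ext r
    simp only [Function.comp_apply]
    rw [← φ.map_add, ← φ.map_add, add_comm]
  rw [h3] at h2
  have h4 := hasMFDerivAt_unique h1 h2
  have h5 := congrArg (fun L ↦ L (1 : ℝ)) h4
  have h6 : mfderiv (𝓡 2) (𝓡 2) (fun y ↦ φ t y) (φ 0 x) ((1 : ℝ) • X (φ 0 x)) =
    (1 : ℝ) • X (φ 0 (φ t x)) := h5
  rw [one_smul, one_smul] at h6
  rw [φ.map_zero_apply (φ t x)] at h6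
  rwa [φ.map_zero_apply x] at h6

end FlowBasics

/-! ### The orthogonal flow in flow coordinates along an orthogonal trajectory. -/

section Strip

variable {M : Type*} [EMetricSpace M] [ChartedSpace (EuclideanSpace ℝ (Fin 2)) M]
  [IsManifold (𝓡 2) ∞ M] [Bundle.RiemannianBundle (fun x : M ↦ TangentSpace (𝓡 2) x)]
  {Ω : AreaForm M} {X : (x : M) → TangentSpace (𝓡 2) x} {φ : Flow ℝ M}

/-- The image of the orthogonal field at `x` under the differential of the time-`τ` map. -/
noncomputable def pushOrth (Ω : AreaForm M) (X : (x : M) → TangentSpace (𝓡 2) x) (φ : Flow ℝ M)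
    (τ : ℝ) (x : M) : TangentSpace (𝓡 2) (φ τ x) :=
  mfderiv (𝓡 2) (𝓡 2) (fun y ↦ φ τ y) x (orthField Ω X x)

/-- The component of the orthogonal field along `X`, in the coordinates given by the flow. -/
noncomputable def slide (Ω : AreaForm M) (X : (x : M) → TangentSpace (𝓡 2) x) (φ : Flow ℝ M)
    (τ : ℝ) (x : M) : ℝ :=
  -(inner ℝ (X (φ τ x)) (pushOrth Ω X φ τ x) / inner ℝ (X (φ τ x)) (X (φ τ x)))

/-- Area preservation gives the pushed vector area `1` with `X`, and adding a multiple of `X` does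
not change this. The multiple `slide` restores orthogonality, so the characterisation `eq_orthField`
applies. -/
theorem orthField_flow (hX : IsSmoothField X) (hφ : IsSmoothFlowOf φ X) (hφΩ : PreservesArea φ Ω)
    {x : M} (hx : x ∉ fixedPts X) (τ : ℝ) :
    orthField Ω X (φ τ x) = slide Ω X φ τ x • X (φ τ x) + pushOrth Ω X φ τ x := by
  have hx' : φ τ x ∉ fixedPts X := fun h ↦ hx ((flow_mem_fixedPts_iff hX hφ).1 h)
  have hXX : inner ℝ (X (φ τ x)) (X (φ τ x)) ≠ 0 := inner_self_ne_zero.2 hx'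
  refine (eq_orthField Ω X _ hx' _ ?_ ?_).symm
  · rw [inner_add_right, inner_smul_right, slide]
    field_simp
    ring
  · rw [map_add, map_smul, Ω.alternating, smul_zero, zero_add, pushOrth,
      ← mfderiv_flow_field hφ τ x, hφΩ, form_orthField Ω X x hx]

/-- The time-zero map leaves the orthogonal field orthogonal to `X`. This makes `0` an equilibrium
of the scalar equation, corresponding to the base curve itself. -/
theorem slide_zero {x : M} : slide Ω X φ 0 x = 0 := by
  have h : (fun y ↦ φ 0 y) = (id : M → M) := funext fun y ↦ φ.map_zero_apply y
  -- The type of the differential depends on the map, so the map is generalised before it is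
  -- replaced by the identity.
  have h1 : ∀ z : M, z = x → ∀ f : M → M, f = id →
      inner ℝ (X (f x)) (mfderiv (𝓡 2) (𝓡 2) f x (orthField Ω X x)) = 0 := by
    rintro z - f rfl
    rw [mfderiv_id]
    exact orthField_orthogonal Ω X x
  rw [slide, pushOrth, h1 x rfl _ h]
  simp

/-- By the chain rule the moving time contributes `slide • X` and the moving point contributes the
pushed orthogonal field; `orthField_flow` adds them up. The equation for `θ` is exactly what makes
the new curve orthogonal. -/
theorem hasMFDerivWithinAt_flow_comp (hX : IsSmoothField X) (hφ : IsSmoothFlowOf φ X)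
    (hφΩ : PreservesArea φ Ω) {β : ℝ → M} {θ : ℝ → ℝ} {I : Set ℝ} {s : ℝ} (hs : s ∈ I)
    (hβ : IsMIntegralCurveOn (I := 𝓡 2) β (orthField Ω X) I) (hβs : β s ∉ fixedPts X)
    (hθ : HasDerivWithinAt θ (slide Ω X φ (θ s) (β s)) I s) :
    HasMFDerivWithinAt 𝓘(ℝ, ℝ) (𝓡 2) (fun s ↦ φ (θ s) (β s)) I s
      ((1 : ℝ →L[ℝ] ℝ).smulRight (orthField Ω X (φ (θ s) (β s)))) := by
  have hΦ := ((hφ.contMDiff (θ s, β s)).mdifferentiableAt (by simp))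
  have hθ' : HasMFDerivWithinAt 𝓘(ℝ, ℝ) 𝓘(ℝ, ℝ) θ I s
      ((1 : ℝ →L[ℝ] ℝ).smulRight (slide Ω X φ (θ s) (β s))) := by
    exact hθ.hasFDerivWithinAt.hasMFDerivWithinAt.congr_mfderiv
      (ContinuousLinearMap.ext fun r ↦ by simp; rfl)
  have hc := hΦ.hasMFDerivAt.comp_hasMFDerivWithinAt s (hθ'.prodMk (hβ s hs))
  refine hc.congr_mfderiv ?_
  ext1
  have hsplit := mfderiv_prod_eq_add_apply (I := 𝓘(ℝ, ℝ)) (I' := 𝓡 2) (I'' := 𝓡 2)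
    (f := fun p : ℝ × M ↦ φ p.1 p.2) (p := (θ s, β s)) (v := (slide Ω X φ (θ s) (β s), orthField Ω X (β s))) hΦ
  have h1 : mfderiv 𝓘(ℝ, ℝ) (𝓡 2) (fun t : ℝ ↦ φ t (β s)) (θ s) =
      (1 : ℝ →L[ℝ] ℝ).smulRight (X (φ (θ s) (β s))) :=
    HasMFDerivAt.mfderiv (hφ.isMIntegralCurve (β s) (θ s))
  have h2 : mfderiv 𝓘(ℝ, ℝ) (𝓡 2) (fun t : ℝ ↦ φ t (β s)) (θ s) (slide Ω X φ (θ s) (β s)) =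
      slide Ω X φ (θ s) (β s) • X (φ (θ s) (β s)) := by
    rw [h1]; rfl
  have h3 : mfderiv (𝓘(ℝ, ℝ).prod (𝓡 2)) (𝓡 2) (fun p : ℝ × M ↦ φ p.1 p.2) (θ s, β s)
      (slide Ω X φ (θ s) (β s), orthField Ω X (β s)) = orthField Ω X (φ (θ s) (β s)) := by
    rw [orthField_flow hX hφ hφΩ hβs, ← h2]
    exact hsplit
  refine Eq.trans ?_ (h3.trans (one_smul ℝ (orthField Ω X (φ (θ s) (β s)))).symm)
  change mfderiv (𝓘(ℝ, ℝ).prod (𝓡 2)) (𝓡 2) (fun p : ℝ × M ↦ φ p.1 p.2) (θ s, β s)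
    ((1 : ℝ) • slide Ω X φ (θ s) (β s), (1 : ℝ) • orthField Ω X (β s)) = _
  rw [one_smul, one_smul]

variable [IsContMDiffRiemannianBundle (𝓡 2) ∞ (EuclideanSpace ℝ (Fin 2))
      (fun x : M ↦ TangentSpace (𝓡 2) x)]

theorem isC1At_orthField (hX : IsSmoothField X) {p : M} (hp : p ∉ fixedPts X) :
    IsC1At (orthField Ω X) p :=
  ContMDiffAt.of_le (contMDiffAt_orthField hX hp) (by simp)

/-- The pushed field is the differential of `(t, x) ↦ φ t x` applied to `(0, Y)`, which exhibits its
joint regularity in the time and in the parameter of `β`. -/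
theorem contDiffOn_slide (hX : IsSmoothField X) (hφ : IsSmoothFlowOf φ X) {β : ℝ → M} {I : Set ℝ}
    (hβ : IsMIntegralCurveOn (I := 𝓡 2) β (orthField Ω X) I) (hreg : ∀ s ∈ I, β s ∉ fixedPts X) :
    ContDiffOn ℝ 1 (fun p : ℝ × ℝ ↦ slide Ω X φ p.1 (β p.2)) (univ ×ˢ I) := by
  have hβ1 : ContMDiffOn 𝓘(ℝ, ℝ) (𝓡 2) 1 β I :=
    contMDiffOn_of_isMIntegralCurveOn hβ fun s hs ↦ isC1At_orthField hX (hreg s hs)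
  have hfst : ContMDiff 𝓘(ℝ, ℝ × ℝ) 𝓘(ℝ, ℝ) 1 (Prod.fst : ℝ × ℝ → ℝ) := contDiff_fst.contMDiff
  have hsnd : ContMDiff 𝓘(ℝ, ℝ × ℝ) 𝓘(ℝ, ℝ) 1 (Prod.snd : ℝ × ℝ → ℝ) := contDiff_snd.contMDiff
  have hβ2 : ContMDiffOn 𝓘(ℝ, ℝ × ℝ) (𝓡 2) 1 (fun p : ℝ × ℝ ↦ β p.2) (univ ×ˢ I) :=
    hβ1.comp hsnd.contMDiffOn fun p hp ↦ hp.2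
  have hY : ContMDiffOn 𝓘(ℝ, ℝ × ℝ) (𝓡 2).tangent 1
      (fun p : ℝ × ℝ ↦ (⟨β p.2, orthField Ω X (β p.2)⟩ : TangentBundle (𝓡 2) M)) (univ ×ˢ I) :=
    fun p hp ↦ ContMDiffAt.comp_contMDiffWithinAt (I' := 𝓡 2)
      (g := fun x ↦ (⟨x, orthField Ω X x⟩ : TangentBundle (𝓡 2) M)) p
      (isC1At_orthField hX (hreg p.2 hp.2)) (hβ2 p hp)
  have hT : ContMDiffOn 𝓘(ℝ, ℝ × ℝ) 𝓘(ℝ, ℝ).tangent 1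
      (fun p : ℝ × ℝ ↦ (⟨p.1, 0⟩ : TangentBundle 𝓘(ℝ, ℝ) ℝ)) (univ ×ˢ I) :=
    ((Bundle.contMDiff_zeroSection ℝ (TangentSpace 𝓘(ℝ, ℝ) : ℝ → Type)).comp hfst).contMDiffOn
  have hA := (contMDiff_equivTangentBundleProd_symm (I := 𝓘(ℝ, ℝ)) (I' := 𝓡 2) (M := ℝ) (M' := M)
    (n := 1)).comp_contMDiffOn (hT.prodMk hY)
  have hB := (ContMDiff.contMDiff_tangentMap (m := 1) hφ.contMDiff
    (by rw [one_add_one_eq_two]; exact ENat.LEInfty.out)).comp_contMDiffOn hA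
  have hpush : ContMDiffOn 𝓘(ℝ, ℝ × ℝ) (𝓡 2).tangent 1
      (fun p : ℝ × ℝ ↦ (⟨φ p.1 (β p.2), pushOrth Ω X φ p.1 (β p.2)⟩ : TangentBundle (𝓡 2) M))
      (univ ×ˢ I) := by
    refine hB.congr fun p hp ↦ ?_
    have hΦ := ((hφ.contMDiff (p.1, β p.2)).mdifferentiableAt (by simp))
    have hsplit := mfderiv_prod_eq_add_apply (I := 𝓘(ℝ, ℝ)) (I' := 𝓡 2) (I'' := 𝓡 2)
      (f := fun p : ℝ × M ↦ φ p.1 p.2) (p := (p.1, β p.2)) (v := ((0 : ℝ), orthField Ω X (β p.2))) hΦ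
    have hz : mfderiv 𝓘(ℝ, ℝ) (𝓡 2) (fun t : ℝ ↦ φ t (β p.2)) p.1 (0 : ℝ) = 0 :=
      (mfderiv 𝓘(ℝ, ℝ) (𝓡 2) (fun t : ℝ ↦ φ t (β p.2)) p.1).map_zero
    have h : pushOrth Ω X φ p.1 (β p.2) =
        mfderiv (𝓘(ℝ, ℝ).prod (𝓡 2)) (𝓡 2) (fun p : ℝ × M ↦ φ p.1 p.2) (p.1, β p.2)
          ((0 : ℝ), orthField Ω X (β p.2)) := by
      refine Eq.trans ?_ hsplit.symm
      rw [hz, zero_add]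
      rfl
    rw [h]
    rfl
  have hXc : ContMDiffOn 𝓘(ℝ, ℝ × ℝ) (𝓡 2).tangent 1
      (fun p : ℝ × ℝ ↦ (⟨φ p.1 (β p.2), X (φ p.1 (β p.2))⟩ : TangentBundle (𝓡 2) M))
      (univ ×ˢ I) :=
    (ContMDiff.of_le (hX : ContMDiff _ _ _ _) (by simp)).comp_contMDiffOn
      ((ContMDiff.of_le hφ.contMDiff (by simp)).comp_contMDiffOn (hfst.contMDiffOn.prodMk hβ2))
  have : IsContMDiffRiemannianBundle (𝓡 2) 1 (EuclideanSpace ℝ (Fin 2))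
    (fun x : M ↦ TangentSpace (𝓡 2) x) := IsContMDiffRiemannianBundle.of_le (n := ∞) (by simp)
  have hN := ContMDiffOn.inner_bundle (b := fun p : ℝ × ℝ ↦ φ p.1 (β p.2)) hXc hpush
  have hD := ContMDiffOn.inner_bundle (b := fun p : ℝ × ℝ ↦ φ p.1 (β p.2)) hXc hXc
  rw [contMDiffOn_iff_contDiffOn] at hN hD
  refine (hN.div hD fun p hp ↦ ?_).neg
  exact inner_self_ne_zero.2 fun h ↦ hreg p.2 hp.2 ((flow_mem_fixedPts_iff hX hφ).1 h)

/-- Near an orthogonal trajectory `β` on `[0, S]`, the orthogonal flow is conjugate to a flow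
on the strip of points `φ τ (β s)`, which preserves the order of `τ`. -/
theorem exists_strip (hX : IsSmoothField X) (hφ : IsSmoothFlowOf φ X) (hφΩ : PreservesArea φ Ω)
    {β : ℝ → M} {S : ℝ} (hS : 0 ≤ S)
    (hβ : IsMIntegralCurveOn (I := 𝓡 2) β (orthField Ω X) (Icc 0 S))
    (hreg : ∀ s ∈ Icc 0 S, β s ∉ fixedPts X) :
    ∃ δ > 0, ∃ θ : ℝ → ℝ → ℝ, (∀ t, θ t 0 = t) ∧ (∀ s ∈ Icc 0 S, θ 0 s = 0) ∧
      (∀ s ∈ Icc 0 S, Monotone fun t ↦ θ t s) ∧ (∀ s ∈ Icc 0 S, Continuous fun t ↦ θ t s) ∧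
      ∀ t, |t| < δ →
        IsMIntegralCurveOn (I := 𝓡 2) (fun s ↦ φ (θ t s) (β s)) (orthField Ω X) (Icc 0 S) := by
  set y : ℝ × ℝ → ℝ := fun p ↦ slide Ω X φ p.1 (β p.2) with hy
  have hyc : ContDiffOn ℝ 1 y (Icc (-1) 1 ×ˢ Icc 0 S) :=
    (contDiffOn_slide hX hφ hβ hreg).mono (prod_mono (subset_univ _) Subset.rfl)
  have hK : IsCompact (Icc (-1 : ℝ) 1 ×ˢ Icc 0 S) := isCompact_Icc.prod isCompact_Icc
  obtain ⟨K, hlip⟩ := hyc.exists_lipschitzOnWith one_ne_zero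
    ((convex_Icc _ _).prod (convex_Icc _ _)) hK
  obtain ⟨C, hC⟩ := hK.exists_bound_of_continuousOn hyc.continuousOn
  -- Truncating the flow time to `[-1, 1]` makes the right-hand side bounded and globally Lipschitz.
  set c : ℝ → ℝ := fun x ↦ projIcc (-1 : ℝ) 1 (by norm_num) x with hc
  have hcm : ∀ x, c x ∈ Icc (-1 : ℝ) 1 := fun x ↦ (projIcc (-1 : ℝ) 1 (by norm_num) x).2
  have hceq : ∀ x ∈ Icc (-1 : ℝ) 1, c x = x := fun x hx ↦ by
    simp only [hc, projIcc_of_mem _ hx]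
  have hclip : LipschitzWith 1 c := LipschitzWith.projIcc _
  have hf1 : ∀ s ∈ Icc 0 S, LipschitzWith K fun x ↦ y (c x, s) := fun s hs ↦ by
    refine LipschitzWith.of_dist_le_mul fun x x' ↦ ?_
    refine (hlip.dist_le_mul _ ⟨hcm x, hs⟩ _ ⟨hcm x', hs⟩).trans ?_
    refine mul_le_mul_of_nonneg_left ?_ K.2
    have := hclip.dist_le_mul x x'
    simpa [Prod.dist_eq] using this
  have hf2 : ∀ x, ContinuousOn (fun s ↦ y (c x, s)) (Icc 0 S) := fun x ↦
    hyc.continuousOn.comp (by fun_prop) fun s hs ↦ ⟨hcm x, hs⟩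
  have hf3 : ∀ s ∈ Icc 0 S, ∀ x, ‖y (c x, s)‖ ≤ C.toNNReal := fun s hs x ↦
    (hC _ ⟨hcm x, hs⟩).trans (Real.le_coe_toNNReal C)
  have hf4 : ∀ s ∈ Icc 0 S, y (c 0, s) = 0 := fun s hs ↦ by
    rw [hceq 0 (by norm_num)]
    exact slide_zero
  obtain ⟨θ, h0, h00, hθ, hmono, C', hC', hL⟩ := exists_scalar_flow (f := fun s x ↦ y (c x, s)) hS
    hf1 hf2 hf3 hf4
  -- With `|t| < 1 / (C' + 1)`, the Lipschitz bound against the zero solution keeps `|θ t s| ≤ 1`,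
  -- where the truncation has no effect.
  refine ⟨1 / (C' + 1), by positivity, θ, h0, h00, hmono, fun s hs ↦ ?_, fun t ht s hs ↦ ?_⟩
  · have : LipschitzWith C'.toNNReal fun t ↦ θ t s := LipschitzWith.of_dist_le_mul fun t t' ↦ by
      rw [Real.dist_eq, Real.dist_eq, Real.coe_toNNReal _ hC']
      exact hL t t' s hs
    exact this.continuous
  · have hsmall : |θ t s| ≤ 1 := by
      have := hL t 0 s hs
      rw [h00 s hs, sub_zero, sub_zero] at this
      rw [lt_div_iff₀ (by positivity)] at ht
      nlinarith [abs_nonneg t]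
    refine hasMFDerivWithinAt_flow_comp hX hφ hφΩ hs hβ (hreg s hs) ?_
    have h := hθ t s hs
    rwa [hceq _ (abs_le.1 hsmall)] at h

end Strip

/-! ### Density-preserving local flows of the plane are locally Hamiltonian. -/

section PlaneHamiltonian

/-- The determinant of two vectors of the plane. -/
def planeDet (u v : EuclideanSpace ℝ (Fin 2)) : ℝ := u 0 * v 1 - u 1 * v 0

/-- The first and second unit vectors of the plane. -/
noncomputable def planeBasis (i : Fin 2) : EuclideanSpace ℝ (Fin 2) := EuclideanSpace.single i 1

/-- The coordinates of the plane. -/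
noncomputable def planeCoord (i : Fin 2) : EuclideanSpace ℝ (Fin 2) →L[ℝ] ℝ := EuclideanSpace.proj i

@[simp]
theorem planeCoord_apply (i : Fin 2) (u : EuclideanSpace ℝ (Fin 2)) : planeCoord i u = u i := rfl

theorem eq_smul_planeBasis (u : EuclideanSpace ℝ (Fin 2)) :
    u = u 0 • planeBasis 0 + u 1 • planeBasis 1 := by
  ext i
  fin_cases i <;> simp [planeBasis]

theorem form_eq_planeDet {F : Type*} [AddCommGroup F] [Module ℝ F] [TopologicalSpace F]
    (B : F →L[ℝ] F →L[ℝ] ℝ) (hB : ∀ v, B v v = 0) (D : EuclideanSpace ℝ (Fin 2) →L[ℝ] F)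
    (u v : EuclideanSpace ℝ (Fin 2)) :
    B (D u) (D v) = B (D (planeBasis 0)) (D (planeBasis 1)) * planeDet u v := by
  have hanti : B (D (planeBasis 1)) (D (planeBasis 0)) =
      -B (D (planeBasis 0)) (D (planeBasis 1)) := by
    have h := hB (D (planeBasis 0) + D (planeBasis 1))
    simp only [map_add, add_apply, hB] at h
    linarith
  conv_lhs => rw [eq_smul_planeBasis u, eq_smul_planeBasis v]
  simp only [map_add, map_smul, add_apply, smul_apply, hB, hanti,
    smul_eq_mul, planeDet]
  ring

variable {V : Set (EuclideanSpace ℝ (Fin 2))} {W : Set (ℝ × EuclideanSpace ℝ (Fin 2))}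
  {f : ℝ × EuclideanSpace ℝ (Fin 2) → EuclideanSpace ℝ (Fin 2)}
  {w : EuclideanSpace ℝ (Fin 2) → ℝ}

/-- A local flow that preserves the density `w` has a generator `Z` with `div (w Z) = 0`. -/
theorem divergence_eq_zero (hV : IsOpen V) (hW : IsOpen W) (hVW : ∀ z ∈ V, ((0 : ℝ), z) ∈ W)
    (hf : ContDiffOn ℝ ∞ f W) (hf0 : ∀ z ∈ V, f (0, z) = z) (hw : ContDiffOn ℝ ∞ w V)
    (hinv : ∀ t z, (t, z) ∈ W → z ∈ V → w (f (t, z)) *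
      planeDet (fderiv ℝ f (t, z) (0, planeBasis 0)) (fderiv ℝ f (t, z) (0, planeBasis 1)) = w z)
    {z : EuclideanSpace ℝ (Fin 2)} (hz : z ∈ V) :
    ∃ L : EuclideanSpace ℝ (Fin 2) →L[ℝ] EuclideanSpace ℝ (Fin 2),
      HasFDerivAt (fun z ↦ fderiv ℝ f (0, z) (1, 0)) L z ∧
      fderiv ℝ w z (fderiv ℝ f (0, z) (1, 0)) +
        w z * (L (planeBasis 0) 0 + L (planeBasis 1) 1) = 0 := by
  have hfz : ContDiffAt ℝ ∞ f (0, z) := hf.contDiffAt (hW.mem_nhds (hVW z hz))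
  have hF : ContDiffAt ℝ ∞ (fderiv ℝ f) (0, z) :=
    hfz.fderiv_right (m := ∞) (by simp)
  set B := fderiv ℝ (fderiv ℝ f) (0, z) with hB
  have hBd : HasFDerivAt (fderiv ℝ f) B (0, z) := (hF.differentiableAt (by simp)).hasFDerivAt
  -- This symmetry exchanges the time derivative of the Jacobian matrix with the space derivative of
  -- the generator.
  have hsymm : ∀ u v, B u v = B v u := fun u v ↦
    (hfz.isSymmSndFDerivAt (by simp only [minSmoothness_of_isRCLikeNormedField]; exact ENat.LEInfty.out)) u v
  have hL : HasFDerivAt (fun z' ↦ fderiv ℝ f (0, z') (1, 0))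
      ((ContinuousLinearMap.apply ℝ (EuclideanSpace ℝ (Fin 2)) ((1 : ℝ), (0 : EuclideanSpace ℝ (Fin 2)))).comp
        (B.comp (ContinuousLinearMap.inr ℝ ℝ (EuclideanSpace ℝ (Fin 2))))) z := by
    refine HasFDerivAt.comp (g := ContinuousLinearMap.apply ℝ (EuclideanSpace ℝ (Fin 2))
      ((1 : ℝ), (0 : EuclideanSpace ℝ (Fin 2)))) z (ContinuousLinearMap.hasFDerivAt _) ?_
    exact HasFDerivAt.comp (g := fderiv ℝ f) z hBd (hasFDerivAt_prodMk_right 0 z)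
  refine ⟨_, hL, ?_⟩
  have hid : ∀ x, fderiv ℝ f (0, z) (0, x) = x := by
    have h1 : HasFDerivAt (fun z' ↦ f (0, z'))
        ((fderiv ℝ f (0, z)).comp (ContinuousLinearMap.inr ℝ ℝ (EuclideanSpace ℝ (Fin 2)))) z :=
      HasFDerivAt.comp (g := f) z (hfz.differentiableAt (by simp)).hasFDerivAt
        (hasFDerivAt_prodMk_right 0 z)
    have h2 : HasFDerivAt (fun z' ↦ f (0, z')) (ContinuousLinearMap.id ℝ _) z :=
      (hasFDerivAt_id z).congr_of_eventuallyEq (by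
        filter_upwards [hV.mem_nhds hz] with y hy using hf0 y hy)
    intro x
    exact congrArg (fun L ↦ L x) (h1.unique h2)
  have hcurve : HasDerivAt (fun t : ℝ ↦ (t, z)) ((1 : ℝ), (0 : EuclideanSpace ℝ (Fin 2))) 0 :=
    (hasDerivAt_id 0).prodMk (hasDerivAt_const 0 z)
  have hA : ∀ j i, HasDerivAt (fun t : ℝ ↦ fderiv ℝ f (t, z) (0, planeBasis j) i)
      (B (1, 0) (0, planeBasis j) i) 0 := by
    intro j i
    have h1 : HasDerivAt (fun t : ℝ ↦ fderiv ℝ f (t, z)) (B (1, 0)) 0 :=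
      hBd.comp_hasDerivAt (0 : ℝ) hcurve
    have h2 := h1.clm_apply (hasDerivAt_const (0 : ℝ) ((0 : ℝ), planeBasis j))
    rw [map_zero, add_zero] at h2
    exact (planeCoord i).hasFDerivAt.comp_hasDerivAt (0 : ℝ) h2
  have hwd : HasDerivAt (fun t : ℝ ↦ w (f (t, z)))
      (fderiv ℝ w z (fderiv ℝ f (0, z) (1, 0))) 0 := by
    have h1 : HasDerivAt (fun t : ℝ ↦ f (t, z)) (fderiv ℝ f (0, z) (1, 0)) 0 :=
      (hfz.differentiableAt (by simp)).hasFDerivAt.comp_hasDerivAt (0 : ℝ) hcurve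
    have h2 : HasFDerivAt w (fderiv ℝ w z) (f (0, z)) := by
      rw [hf0 z hz]
      exact ((hw.contDiffAt (hV.mem_nhds hz)).differentiableAt (by simp)).hasFDerivAt
    exact h2.comp_hasDerivAt (0 : ℝ) h1
  -- The time derivative at `0` of density times Jacobian determinant. By invariance the product is
  -- constant in time, so comparing with the derivative of a constant gives the divergence identity.
  have hprod := hwd.mul (((hA 0 0).mul (hA 1 1)).sub ((hA 0 1).mul (hA 1 0)))
  have hconst : HasDerivAt (fun _ : ℝ ↦ w z) 0 (0 : ℝ) := hasDerivAt_const _ _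
  have heq : (fun _ : ℝ ↦ w z) =ᶠ[𝓝 (0 : ℝ)] ((fun t : ℝ ↦ w (f (t, z))) * ((fun t : ℝ ↦
      fderiv ℝ f (t, z) (0, planeBasis 0) 0) * (fun t : ℝ ↦ fderiv ℝ f (t, z) (0, planeBasis 1) 1) -
      (fun t : ℝ ↦ fderiv ℝ f (t, z) (0, planeBasis 0) 1) *
      fun t : ℝ ↦ fderiv ℝ f (t, z) (0, planeBasis 1) 0)) := by
    have hev : ∀ᶠ t : ℝ in 𝓝 0, (t, z) ∈ W :=
      hcurve.continuousAt.eventually (hW.mem_nhds (hVW z hz))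
    filter_upwards [hev] with t ht using (hinv t z ht hz).symm
  have h := hprod.unique (hconst.congr_of_eventuallyEq heq.symm)
  simp only [hid, hf0 z hz, Pi.mul_apply, Pi.sub_apply] at h
  simp only [planeBasis, PiLp.single_apply] at h
  simp only [ContinuousLinearMap.comp_apply, ContinuousLinearMap.apply_apply,
    ContinuousLinearMap.inr_apply]
  rw [hsymm (0, planeBasis 0), hsymm (0, planeBasis 1)]
  simp at h
  simp only [planeBasis]
  linarith

/-- A local flow of the plane that preserves the density `w` is locally Hamiltonian. -/
theorem exists_plane_hamiltonian (hV : IsOpen V) (hW : IsOpen W)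
    (hVW : ∀ z ∈ V, ((0 : ℝ), z) ∈ W)
    (hf : ContDiffOn ℝ ∞ f W) (hf0 : ∀ z ∈ V, f (0, z) = z) (hw : ContDiffOn ℝ ∞ w V)
    (hinv : ∀ t z, (t, z) ∈ W → z ∈ V → w (f (t, z)) *
      planeDet (fderiv ℝ f (t, z) (0, planeBasis 0)) (fderiv ℝ f (t, z) (0, planeBasis 1)) = w z)
    {z₀ : EuclideanSpace ℝ (Fin 2)} (hz₀ : z₀ ∈ V) :
    ∃ (r : ℝ) (h : EuclideanSpace ℝ (Fin 2) → ℝ), 0 < r ∧ Metric.ball z₀ r ⊆ V ∧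
      ContDiffOn ℝ ∞ h (Metric.ball z₀ r) ∧ ∀ z ∈ Metric.ball z₀ r, ∀ v,
        fderiv ℝ h z v = w z * planeDet (fderiv ℝ f (0, z) (1, 0)) v := by
  obtain ⟨r, hr, hrV⟩ := Metric.isOpen_iff.1 hV z₀ hz₀
  set Z : EuclideanSpace ℝ (Fin 2) → EuclideanSpace ℝ (Fin 2) := fun z ↦ fderiv ℝ f (0, z) (1, 0)
    with hZ
  -- The contraction of the area form of density `w` with the generator; it is closed precisely
  -- because `w Z` has divergence zero.
  set α : EuclideanSpace ℝ (Fin 2) → EuclideanSpace ℝ (Fin 2) →L[ℝ] ℝ := fun z ↦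
    (w z * Z z 0) • planeCoord 1 - (w z * Z z 1) • planeCoord 0 with hα
  have hαv : ∀ z v, α z v = w z * planeDet (Z z) v := by
    intro z v
    simp [hα, planeDet]
    ring
  have hZs : ContDiffOn ℝ ∞ Z V := by
    intro z hz
    have hfz : ContDiffAt ℝ ∞ f (0, z) := hf.contDiffAt (hW.mem_nhds (hVW z hz))
    have hF : ContDiffAt ℝ ∞ (fderiv ℝ f) (0, z) := hfz.fderiv_right (m := ∞) (by simp)
    exact ((hF.comp z (contDiffAt_const.prodMk contDiffAt_id)).clm_apply
      contDiffAt_const).contDiffWithinAt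
  have hZi : ∀ i, ContDiffOn ℝ ∞ (fun z ↦ Z z i) V := fun i ↦ (planeCoord i).contDiff.comp_contDiffOn hZs
  have hαs : ContDiffOn ℝ ∞ α V :=
    ((hw.mul (hZi 0)).smul contDiffOn_const).sub ((hw.mul (hZi 1)).smul contDiffOn_const)
  have hsym : ∀ a ∈ Metric.ball z₀ r, ∀ x y, fderiv ℝ α a x y = fderiv ℝ α a y x := by
    intro a ha x y
    obtain ⟨L, hL, hdiv⟩ := divergence_eq_zero hV hW hVW hf hf0 hw hinv (hrV ha)
    have hwd : HasFDerivAt w (fderiv ℝ w a) a :=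
      ((hw.contDiffAt (hV.mem_nhds (hrV ha))).differentiableAt (by simp)).hasFDerivAt
    have hZd : ∀ i, HasFDerivAt (fun z ↦ Z z i) ((planeCoord i).comp L) a := fun i ↦
      (planeCoord i).hasFDerivAt.comp a hL
    have hd := ((hwd.mul (hZd 0)).smul_const (planeCoord 1)).sub ((hwd.mul (hZd 1)).smul_const (planeCoord 0))
    have hd' : HasFDerivAt α _ a := hd
    rw [hd'.fderiv]
    have hx : ∀ u, fderiv ℝ w a u = u 0 * fderiv ℝ w a (planeBasis 0) +
        u 1 * fderiv ℝ w a (planeBasis 1) := fun u ↦ by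
      conv_lhs => rw [eq_smul_planeBasis u]
      simp
    have hy : ∀ u i, L u i = u 0 * L (planeBasis 0) i + u 1 * L (planeBasis 1) i := fun u i ↦ by
      conv_lhs => rw [eq_smul_planeBasis u]
      simp
    rw [hx] at hdiv
    simp
    rw [hx x, hx y, hy x 0, hy x 1, hy y 0, hy y 1]
    linear_combination (x 0 * y 1 - x 1 * y 0) * hdiv
  -- The Poincaré lemma on a ball.
  obtain ⟨h, hh⟩ := (convex_ball z₀ r).exists_forall_hasFDerivAt_of_fderiv_symmetric
    Metric.isOpen_ball ((hαs.differentiableOn (by simp)).mono hrV) hsym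
  refine ⟨r, h, hr, hrV, ?_, fun z hz v ↦ by rw [(hh z hz).fderiv, hαv]⟩
  rw [contDiffOn_infty_iff_fderiv_of_isOpen Metric.isOpen_ball]
  exact ⟨fun z hz ↦ (hh z hz).differentiableAt.differentiableWithinAt,
    (hαs.mono hrV).congr fun z hz ↦ (hh z hz).fderiv⟩

end PlaneHamiltonian

/-! ### Existence of local Hamiltonians on the surface. -/

section LocalHamiltonian

variable {M : Type*} [TopologicalSpace M] [ChartedSpace (EuclideanSpace ℝ (Fin 2)) M]
  [IsManifold (𝓡 2) ∞ M] {Ω : AreaForm M} {X : (x : M) → TangentSpace (𝓡 2) x} {φ : Flow ℝ M}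

/-- The area form on vectors of the model plane. -/
noncomputable def modelForm (Ω : AreaForm M) (x : M) (u v : EuclideanSpace ℝ (Fin 2)) : ℝ := Ω.form x u v

/-- The vector field as a function with values in the model plane. -/
def modelField (X : (x : M) → TangentSpace (𝓡 2) x) (x : M) : EuclideanSpace ℝ (Fin 2) := X x

/-- The differential of the inverse chart at `p`, as a map of the model plane. -/
noncomputable def chartFrame (p : M) (z : EuclideanSpace ℝ (Fin 2)) :
    EuclideanSpace ℝ (Fin 2) →L[ℝ] EuclideanSpace ℝ (Fin 2) :=
  mfderiv 𝓘(ℝ, EuclideanSpace ℝ (Fin 2)) (𝓡 2) (extChartAt (𝓡 2) p).symm z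

/-- The density of the area form in the chart at `p`. -/
noncomputable def chartDensity (Ω : AreaForm M) (p : M) (z : EuclideanSpace ℝ (Fin 2)) : ℝ :=
  modelForm Ω ((extChartAt (𝓡 2) p).symm z) (chartFrame p z (planeBasis 0))
    (chartFrame p z (planeBasis 1))

theorem modelForm_chartFrame (Ω : AreaForm M) (p : M) (z u v : EuclideanSpace ℝ (Fin 2)) :
    modelForm Ω ((extChartAt (𝓡 2) p).symm z) (chartFrame p z u) (chartFrame p z v) =
      chartDensity Ω p z * planeDet u v :=
  form_eq_planeDet (F := EuclideanSpace ℝ (Fin 2)) (Ω.form ((extChartAt (𝓡 2) p).symm z))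
    (Ω.alternating _) (chartFrame p z) u v

theorem hasMFDerivAt_extChartAt_symm {p : M} {z : EuclideanSpace ℝ (Fin 2)}
    (hz : z ∈ (extChartAt (𝓡 2) p).target) :
    HasMFDerivAt 𝓘(ℝ, EuclideanSpace ℝ (Fin 2)) (𝓡 2) (extChartAt (𝓡 2) p).symm z
      (chartFrame p z) :=
  (((contMDiffOn_extChartAt_symm (n := ∞) p).contMDiffAt
    ((isOpen_extChartAt_target p).mem_nhds hz)).mdifferentiableAt (by simp)).hasMFDerivAt

theorem contMDiffOn_chartFrame (p : M) (u : EuclideanSpace ℝ (Fin 2)) :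
    ContMDiffOn 𝓘(ℝ, EuclideanSpace ℝ (Fin 2)) (𝓡 2).tangent ∞
      (fun z ↦ (⟨(extChartAt (𝓡 2) p).symm z, chartFrame p z u⟩ : TangentBundle (𝓡 2) M))
      (extChartAt (𝓡 2) p).target := by
  have hopen := isOpen_extChartAt_target (I := 𝓡 2) p
  have h1 := (contMDiffOn_extChartAt_symm (I := 𝓡 2) (n := ∞) p).contMDiffOn_tangentMapWithin
    (m := ∞) (by simp) hopen.uniqueMDiffOn
  have h2 : ContMDiff 𝓘(ℝ, EuclideanSpace ℝ (Fin 2)) 𝓘(ℝ, EuclideanSpace ℝ (Fin 2)).tangent ∞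
      (fun z ↦ (⟨z, u⟩ : TangentBundle 𝓘(ℝ, EuclideanSpace ℝ (Fin 2)) (EuclideanSpace ℝ (Fin 2)))) :=
    contMDiff_vectorSpace_iff_contDiff.2 contDiff_const
  refine (h1.comp h2.contMDiffOn fun z hz ↦ hz).congr fun z hz ↦ ?_
  simp only [Function.comp_apply, tangentMapWithin, mfderivWithin_of_isOpen hopen hz]
  rfl

theorem contDiffOn_chartDensity (Ω : AreaForm M) (p : M) :
    ContDiffOn ℝ ∞ (chartDensity Ω p) (extChartAt (𝓡 2) p).target := by
  rw [← contMDiffOn_iff_contDiffOn]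
  intro z hz
  have h := ContMDiffWithinAt.clm_bundle_apply₂ (IB := 𝓡 2) (E₃ := fun _ : M ↦ ℝ) (F₃ := ℝ)
    (b := (extChartAt (𝓡 2) p).symm)
    (Ω.contMDiff.contMDiffAt.comp_contMDiffWithinAt z (contMDiffOn_extChartAt_symm p z hz))
    (contMDiffOn_chartFrame p (planeBasis 0) z hz) (contMDiffOn_chartFrame p (planeBasis 1) z hz)
  rw [Bundle.contMDiffWithinAt_totalSpace] at h
  exact h.2

theorem exists_localHamiltonian (Ω : AreaForm M) (hφ : IsSmoothFlowOf φ X)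
    (hφΩ : PreservesArea φ Ω) (p : M) :
    ∃ (U : Set M) (H : M → ℝ), p ∈ U ∧ IsLocalHamiltonian Ω X U H := by
  set e := extChartAt (𝓡 2) p with he
  have hV : IsOpen e.target := isOpen_extChartAt_target p
  have hsymm : ContMDiffOn 𝓘(ℝ, EuclideanSpace ℝ (Fin 2)) (𝓡 2) ∞ e.symm e.target :=
    contMDiffOn_extChartAt_symm p
  have hfst : ContMDiff 𝓘(ℝ, ℝ × EuclideanSpace ℝ (Fin 2)) 𝓘(ℝ, ℝ) ∞
    (Prod.fst : ℝ × EuclideanSpace ℝ (Fin 2) → ℝ) := contDiff_fst.contMDiff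
  have hsnd : ContMDiff 𝓘(ℝ, ℝ × EuclideanSpace ℝ (Fin 2)) 𝓘(ℝ, EuclideanSpace ℝ (Fin 2)) ∞
    (Prod.snd : ℝ × EuclideanSpace ℝ (Fin 2) → EuclideanSpace ℝ (Fin 2)) := contDiff_snd.contMDiff
  set Φ : ℝ × EuclideanSpace ℝ (Fin 2) → M := fun q ↦ φ q.1 (e.symm q.2) with hΦ
  have hΦs : ContMDiffOn 𝓘(ℝ, ℝ × EuclideanSpace ℝ (Fin 2)) (𝓡 2) ∞ Φ (univ ×ˢ e.target) :=
    hφ.contMDiff.comp_contMDiffOn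
      (hfst.contMDiffOn.prodMk (hsymm.comp hsnd.contMDiffOn fun q hq ↦ hq.2))
  set W : Set (ℝ × EuclideanSpace ℝ (Fin 2)) := (univ ×ˢ e.target) ∩ Φ ⁻¹' e.source with hWdef
  have hW : IsOpen W := hΦs.continuousOn.isOpen_inter_preimage (isOpen_univ.prod hV)
    (isOpen_extChartAt_source p)
  set f : ℝ × EuclideanSpace ℝ (Fin 2) → EuclideanSpace ℝ (Fin 2) := fun q ↦ e (Φ q) with hf
  have hfs : ContDiffOn ℝ ∞ f W := by
    rw [← contMDiffOn_iff_contDiffOn]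
    have := contMDiffOn_extChartAt (I := 𝓡 2) (n := ∞) (x := p)
    rw [← extChartAt_source (𝓡 2)] at this
    exact this.comp (hΦs.mono inter_subset_left) fun q hq ↦ hq.2
  have hΦ0 : ∀ z, Φ (0, z) = e.symm z := fun z ↦ φ.map_zero_apply _
  have hVW : ∀ z ∈ e.target, ((0 : ℝ), z) ∈ W := fun z hz ↦
    ⟨⟨mem_univ _, hz⟩, by rw [mem_preimage, hΦ0]; exact e.map_target hz⟩
  have hf0 : ∀ z ∈ e.target, f (0, z) = z := fun z hz ↦ by
    simp only [hf, hΦ0, e.right_inv hz]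
  have hfe : ∀ q ∈ W, e.symm (f q) = Φ q := fun q hq ↦ e.left_inv hq.2
  have hft : ∀ q ∈ W, f q ∈ e.target := fun q hq ↦ e.map_source hq.2
  have hfd : ∀ q ∈ W, HasFDerivAt f (fderiv ℝ f q) q := fun q hq ↦
    ((hfs.contDiffAt (hW.mem_nhds hq)).differentiableAt (by simp)).hasFDerivAt
  have hinv : ∀ t z, (t, z) ∈ W → z ∈ e.target → chartDensity Ω p (f (t, z)) *
      planeDet (fderiv ℝ f (t, z) (0, planeBasis 0)) (fderiv ℝ f (t, z) (0, planeBasis 1)) =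
        chartDensity Ω p z := by
    intro t z htz hz
    set P : EuclideanSpace ℝ (Fin 2) →L[ℝ] EuclideanSpace ℝ (Fin 2) :=
      mfderiv (𝓡 2) (𝓡 2) (fun y ↦ φ t y) (e.symm z) with hP
    -- Both sides are the differential at `z` of the time-`t` map composed with the inverse chart:
    -- once through the chart expression `f`, once directly.
    have hpush : ∀ u, chartFrame p (f (t, z)) (fderiv ℝ f (t, z) (0, u)) = P (chartFrame p z u) := by
      have h1 : HasMFDerivAt 𝓘(ℝ, EuclideanSpace ℝ (Fin 2)) 𝓘(ℝ, EuclideanSpace ℝ (Fin 2))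
          (fun z' ↦ f (t, z')) z ((fderiv ℝ f (t, z)).comp
            (ContinuousLinearMap.inr ℝ ℝ (EuclideanSpace ℝ (Fin 2)))) :=
        (HasFDerivAt.comp (g := f) z (hfd _ htz) (hasFDerivAt_prodMk_right t z)).hasMFDerivAt
      have h2 := HasMFDerivAt.comp z (hasMFDerivAt_extChartAt_symm (hft _ htz)) h1
      have h3 := HasMFDerivAt.comp z
        ((contMDiff_flow hφ t (e.symm z)).mdifferentiableAt (by simp)).hasMFDerivAt
        (hasMFDerivAt_extChartAt_symm hz)
      have h4 : (fun y ↦ φ t y) ∘ e.symm =ᶠ[𝓝 z] e.symm ∘ fun z' ↦ f (t, z') := by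
        have : ∀ᶠ z' in 𝓝 z, (t, z') ∈ W :=
          (Continuous.prodMk_right t).continuousAt.eventually (hW.mem_nhds htz)
        filter_upwards [this] with z' hz' using (hfe _ hz').symm
      have h5 := hasMFDerivAt_unique h2 (h3.congr_of_eventuallyEq h4.symm)
      intro u
      exact congrArg (fun L : EuclideanSpace ℝ (Fin 2) →L[ℝ] EuclideanSpace ℝ (Fin 2) ↦ L u) h5
    rw [← modelForm_chartFrame, hpush, hpush, ← he, hfe _ htz]
    exact hφΩ t (e.symm z) _ _
  obtain ⟨r, h, hr, hrV, hhs, hh⟩ := exists_plane_hamiltonian hV hW hVW hfs hf0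
    (contDiffOn_chartDensity Ω p) hinv (mem_extChartAt_target (I := 𝓡 2) p)
  have hgen : ∀ z ∈ e.target, chartFrame p z (fderiv ℝ f (0, z) (1, 0)) =
      modelField X (e.symm z) := by
    intro z hz
    have h1 : HasMFDerivAt 𝓘(ℝ, ℝ) 𝓘(ℝ, EuclideanSpace ℝ (Fin 2)) (fun t : ℝ ↦ f (t, z)) 0
        ((fderiv ℝ f (0, z)).comp (ContinuousLinearMap.inl ℝ ℝ (EuclideanSpace ℝ (Fin 2)))) :=
      (HasFDerivAt.comp (g := f) (0 : ℝ) (hfd _ (hVW z hz)) (hasFDerivAt_prodMk_left 0 z)).hasMFDerivAt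
    have h2 := HasMFDerivAt.comp (0 : ℝ) (hasMFDerivAt_extChartAt_symm (hft _ (hVW z hz))) h1
    have h3 := hφ.isMIntegralCurve (e.symm z) 0
    have h4 : (fun t : ℝ ↦ φ t (e.symm z)) =ᶠ[𝓝 0] e.symm ∘ fun t : ℝ ↦ f (t, z) := by
      have : ∀ᶠ t : ℝ in 𝓝 0, (t, z) ∈ W :=
        (Continuous.prodMk_left z).continuousAt.eventually (hW.mem_nhds (hVW z hz))
      filter_upwards [this] with t ht using (hfe _ ht).symm
    have h5 := hasMFDerivAt_unique h2 (h3.congr_of_eventuallyEq h4.symm)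
    have h6 : chartFrame p (f (0, z)) (fderiv ℝ f (0, z) (1, 0)) =
        (1 : ℝ) • modelField X (φ 0 (e.symm z)) :=
      congrArg (fun L : ℝ →L[ℝ] EuclideanSpace ℝ (Fin 2) ↦ L 1) h5
    rwa [hf0 z hz, one_smul, φ.map_zero_apply] at h6
  have hes : ContMDiffOn (𝓡 2) 𝓘(ℝ, EuclideanSpace ℝ (Fin 2)) ∞ e e.source := by
    have := contMDiffOn_extChartAt (I := 𝓡 2) (n := ∞) (x := p)
    rwa [← extChartAt_source (𝓡 2)] at this
  refine ⟨e.source ∩ e ⁻¹' Metric.ball (e p) r, fun x ↦ h (e x),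
    ⟨mem_extChartAt_source p, Metric.mem_ball_self hr⟩, ?_, ?_, ?_⟩
  · exact hes.continuousOn.isOpen_inter_preimage (isOpen_extChartAt_source p) Metric.isOpen_ball
  · exact hhs.contMDiffOn.comp (hes.mono inter_subset_left) fun x hx ↦ hx.2
  · rintro x ⟨hx, hxb⟩ v
    have hhd : HasMFDerivAt 𝓘(ℝ, EuclideanSpace ℝ (Fin 2)) 𝓘(ℝ, ℝ) h (e x) (fderiv ℝ h (e x)) :=
      ((hhs.contDiffAt (Metric.isOpen_ball.mem_nhds hxb)).differentiableAt
        (by simp)).hasFDerivAt.hasMFDerivAt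
    have hed := ((hes.contMDiffAt ((isOpen_extChartAt_source p).mem_nhds hx)).mdifferentiableAt
      (by simp)).hasMFDerivAt
    have hc := HasMFDerivAt.comp x hhd hed
    have hxt : e x ∈ e.target := e.map_source hx
    have hxx : e.symm (e x) = x := e.left_inv hx
    obtain ⟨A, hA⟩ : ∃ A : EuclideanSpace ℝ (Fin 2) →L[ℝ] EuclideanSpace ℝ (Fin 2),
      A = mfderiv (𝓡 2) 𝓘(ℝ, EuclideanSpace ℝ (Fin 2)) e x := ⟨_, rfl⟩
    -- Differentiate `e.symm ∘ e = id` near `x`.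
    have hframe : ∀ u : EuclideanSpace ℝ (Fin 2), chartFrame p (e x) (A u) = u := by
      intro u
      have h1 := HasMFDerivAt.comp x (hasMFDerivAt_extChartAt_symm hxt) hed
      have h2 : (id : M → M) =ᶠ[𝓝 x] e.symm ∘ e := by
        filter_upwards [(isOpen_extChartAt_source p).mem_nhds hx] with y hy
          using (e.left_inv hy).symm
      have h3 := hasMFDerivAt_unique h1 ((hasMFDerivAt_id x).congr_of_eventuallyEq h2.symm)
      rw [hA]
      exact congrArg (fun L : EuclideanSpace ℝ (Fin 2) →L[ℝ] EuclideanSpace ℝ (Fin 2) ↦ L u) h3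
    have h1 : mfderiv (𝓡 2) 𝓘(ℝ, ℝ) (fun x ↦ h (e x)) x v = fderiv ℝ h (e x) (A v) := by
      rw [hA]
      exact congrArg (fun L : EuclideanSpace ℝ (Fin 2) →L[ℝ] ℝ ↦ L v) hc.mfderiv
    have h2 : ∀ u : EuclideanSpace ℝ (Fin 2), fderiv ℝ h (e x) (A u) =
        modelForm Ω x (modelField X x) u := by
      intro u
      rw [hh _ hxb, ← modelForm_chartFrame, hgen _ hxt, hframe, ← he, hxx]
    exact h1.trans (h2 v)

end LocalHamiltonian

/-! ### Limits of non-fixed trajectories are saddles. -/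

section Saddles

variable {M : Type*} [TopologicalSpace M] [ChartedSpace (EuclideanSpace ℝ (Fin 2)) M]
  [IsManifold (𝓡 2) ∞ M] {Ω : AreaForm M} {X : (x : M) → TangentSpace (𝓡 2) x} {φ : Flow ℝ M}

/-- At an extremum `dH = Ω(X, ·)` vanishes by Fermat's theorem in a chart, and nondegeneracy gives
`X x = 0`. -/
theorem mem_fixedPts_of_isLocalExtr {U : Set M} {H : M → ℝ} (hH : IsLocalHamiltonian Ω X U H)
    {x : M} (hx : x ∈ U) (hext : IsLocalExtr H x) : x ∈ fixedPts X := by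
  set e := extChartAt (𝓡 2) x with he
  have hd : MDifferentiableAt (𝓡 2) 𝓘(ℝ, ℝ) H x :=
    ((hH.contMDiffOn x hx).contMDiffAt (hH.isOpen.mem_nhds hx)).mdifferentiableAt (by simp)
  have hz : mfderiv (𝓡 2) 𝓘(ℝ, ℝ) H x = 0 := by
    have hext' : IsLocalExtr (H ∘ e.symm) (e x) := by
      have hc : Tendsto e.symm (𝓝 (e x)) (𝓝 x) := by
        have := (continuousAt_extChartAt_symm (I := 𝓡 2) x).tendsto
        rwa [extChartAt_to_inv] at this
      have h : IsExtrFilter (H ∘ e.symm) (map e.symm (𝓝 (e x)) |>.comap e.symm) (e x) := by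
        have h0 : e.symm (e x) = x := extChartAt_to_inv x
        rcases hext with hm | hm
        · left
          show ∀ᶠ z in _, H (e.symm (e x)) ≤ H (e.symm z)
          rw [h0]
          exact (tendsto_comap.mono_right hc).eventually hm
        · right
          show ∀ᶠ z in _, H (e.symm z) ≤ H (e.symm (e x))
          rw [h0]
          exact (tendsto_comap.mono_right hc).eventually hm
      exact h.filter_mono le_comap_map
    have h1 := hext'.fderiv_eq_zero
    rw [hd.mfderiv]
    simp only [mfld_simps, writtenInExtChartAt, fderivWithin_univ]
    exact h1
  refine Ω.nondegenerate x _ fun v ↦ ?_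
  rw [← hH.mfderiv_eq x hx v, hz]
  rfl

/-- A fixed point to which a non-fixed trajectory converges is a saddle. -/
theorem isSaddle_of_tendsto_aux [T2Space M] (hX : IsSmoothField X) (hφ : IsSmoothFlowOf φ X)
    (hφΩ : PreservesArea φ Ω) {p c : M} (hp : p ∈ fixedPts X) (hc : c ∉ fixedPts X) {l : Filter ℝ}
    [l.NeBot] (hl : ∀ s ∈ l, ∃ S ∈ l, Convex ℝ S ∧ S ⊆ s)
    (h : Tendsto (fun t : ℝ ↦ φ t c) l (𝓝 p)) : IsSaddle Ω X p := by
  obtain ⟨U, H, hpU, hH⟩ := exists_localHamiltonian Ω hφ hφΩ p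
  refine ⟨hp, U, H, hpU, hH, fun hext ↦ ?_⟩
  -- Convexity of `S` turns a zero derivative into constancy; asking for a convex basis treats both
  -- ends of the time line at once.
  obtain ⟨S, hSl, hSc, hSU⟩ := hl _ (h.eventually (hH.isOpen.mem_nhds hpU))
  have hder : ∀ t ∈ S, HasDerivAt (fun t ↦ H (φ t c)) 0 t := by
    intro t ht
    have hd : HasMFDerivAt (𝓡 2) 𝓘(ℝ, ℝ) H (φ t c) (mfderiv (𝓡 2) 𝓘(ℝ, ℝ) H (φ t c)) :=
      (((hH.contMDiffOn _ (hSU ht)).contMDiffAt (hH.isOpen.mem_nhds (hSU ht))).mdifferentiableAt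
        (by simp)).hasMFDerivAt
    have hcomp := hd.comp t (hφ.isMIntegralCurve c t)
    have h' : HasFDerivAt (fun t ↦ H (φ t c)) (0 : ℝ →L[ℝ] ℝ) t := by
      refine HasMFDerivAt.hasFDerivAt (hcomp.congr_mfderiv ?_)
      ext1
      have h1 : mfderiv (𝓡 2) 𝓘(ℝ, ℝ) H (φ t c) (X (φ t c)) = (0 : ℝ) := by
        rw [hH.mfderiv_eq _ (hSU ht), Ω.alternating]
      exact ((mfderiv (𝓡 2) 𝓘(ℝ, ℝ) H (φ t c)).map_smul (1 : ℝ) (X (φ t c))).trans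
        ((congrArg (fun r : ℝ ↦ (1 : ℝ) • r) h1).trans (smul_zero _))
    simpa using h'.hasDerivAt
  have hconst : ∀ t ∈ S, ∀ t' ∈ S, H (φ t c) = H (φ t' c) := by
    intro t ht t' ht'
    have := hSc.norm_image_sub_le_of_norm_hasDerivWithin_le (C := 0) (f := fun t ↦ H (φ t c))
      (fun r hr ↦ (hder r hr).hasDerivWithinAt) (fun _ _ ↦ by simp) ht' ht
    rw [zero_mul, norm_le_zero_iff, sub_eq_zero] at this
    exact this
  have hlim : Tendsto (fun t ↦ H (φ t c)) l (𝓝 (H p)) :=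
    ((hH.contMDiffOn.continuousOn.continuousAt (hH.isOpen.mem_nhds hpU)).tendsto).comp h
  have hval : ∀ t ∈ S, H (φ t c) = H p := by
    intro t ht
    refine tendsto_nhds_unique (l := l) (tendsto_const_nhds.congr' ?_) hlim
    filter_upwards [hSl] with t' ht' using hconst t ht t' ht'
  -- Points of the trajectory close to `p` share the value `H p`, so an extremum at `p` is an
  -- extremum at them too. They would then be fixed.
  have hfin : ∃ t ∈ S, IsLocalExtr H (φ t c) := by
    rcases hext with hm | hm
    · obtain ⟨t, ht, htS⟩ := ((h.eventually hm.eventually_nhds).and hSl).exists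
      refine ⟨t, htS, Or.inl ?_⟩
      show ∀ᶠ y in 𝓝 (φ t c), H (φ t c) ≤ H y
      rwa [hval t htS]
    · obtain ⟨t, ht, htS⟩ := ((h.eventually hm.eventually_nhds).and hSl).exists
      refine ⟨t, htS, Or.inr ?_⟩
      show ∀ᶠ y in 𝓝 (φ t c), H y ≤ H (φ t c)
      rwa [hval t htS]
  obtain ⟨t, ht, hex⟩ := hfin
  exact hc ((flow_mem_fixedPts_iff hX hφ).1 (mem_fixedPts_of_isLocalExtr hH (hSU ht) hex))

theorem isSaddle_of_tendsto_atTop [T2Space M] (hX : IsSmoothField X) (hφ : IsSmoothFlowOf φ X)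
    (hφΩ : PreservesArea φ Ω) {p c : M} (hp : p ∈ fixedPts X) (hc : c ∉ fixedPts X)
    (h : Tendsto (fun t : ℝ ↦ φ t c) atTop (𝓝 p)) : IsSaddle Ω X p := by
  refine isSaddle_of_tendsto_aux hX hφ hφΩ hp hc (fun s hs ↦ ?_) h
  obtain ⟨a, ha⟩ := mem_atTop_sets.1 hs
  exact ⟨Ici a, Ici_mem_atTop a, convex_Ici a, ha⟩

theorem isSaddle_of_tendsto_atBot [T2Space M] (hX : IsSmoothField X) (hφ : IsSmoothFlowOf φ X)
    (hφΩ : PreservesArea φ Ω) {p c : M} (hp : p ∈ fixedPts X) (hc : c ∉ fixedPts X)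
    (h : Tendsto (fun t : ℝ ↦ φ t c) atBot (𝓝 p)) : IsSaddle Ω X p := by
  refine isSaddle_of_tendsto_aux hX hφ hφΩ hp hc (fun s hs ↦ ?_) h
  obtain ⟨a, ha⟩ := mem_atBot_sets.1 hs
  exact ⟨Iic a, Iic_mem_atBot a, convex_Iic a, ha⟩

end Saddles

/-! ### Paths running along trajectories and their behaviour at fixed points. -/

section Arcs

variable {M : Type*} [TopologicalSpace M] {φ : Flow ℝ M} {g : ℝ → M} {Z : Set M} {T : ℝ}

/-- The path `g` on `[a, b]` runs forward through a piece of trajectory. -/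
def IsArc (φ : Flow ℝ M) (g : ℝ → M) (a b : ℝ) : Prop :=
  ∃ ρ : ℝ, 0 ≤ ρ ∧ φ ρ (g a) = g b ∧ g '' Icc a b = (fun t ↦ φ t (g a)) '' Icc 0 ρ

theorem IsArc.trans {a b c : ℝ} (hab : a ≤ b) (hbc : b ≤ c) (h : IsArc φ g a b)
    (h' : IsArc φ g b c) : IsArc φ g a c := by
  obtain ⟨ρ, hρ, he, him⟩ := h
  obtain ⟨ρ', hρ', he', him'⟩ := h'
  have hadd : ∀ t, φ (t + ρ) (g a) = φ t (g b) := fun t ↦ by rw [φ.map_add, he]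
  refine ⟨ρ' + ρ, by positivity, by rw [hadd, he'], ?_⟩
  rw [← Icc_union_Icc_eq_Icc hab hbc, image_union, him, him',
    ← Icc_union_Icc_eq_Icc hρ (by linarith : ρ ≤ ρ' + ρ), image_union]
  congr 1
  ext x
  constructor
  · rintro ⟨t, ht, rfl⟩
    exact ⟨t + ρ, ⟨by linarith [ht.1], by linarith [ht.2]⟩, hadd t⟩
  · rintro ⟨t, ht, rfl⟩
    refine ⟨t - ρ, ⟨by linarith [ht.1], by linarith [ht.2]⟩, ?_⟩
    simp only
    rw [← hadd, sub_add_cancel]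

/-- The path `g` locally runs forward along trajectories at the times where it is not in `Z`. -/
def IsLocallyArc (φ : Flow ℝ M) (g : ℝ → M) (Z : Set M) (T : ℝ) : Prop :=
  ∀ t ∈ Icc 0 T, g t ∉ Z → ∃ δ > 0, ∀ t' ∈ Icc 0 T, ∀ t'' ∈ Icc 0 T, |t' - t| < δ → |t'' - t| < δ →
    t' ≤ t'' → IsArc φ g t' t''

/-- Continuous induction along `[a, b]`, using that consecutive arcs concatenate. -/
theorem IsLocallyArc.isArc (h : IsLocallyArc φ g Z T) {a b : ℝ} (ha : 0 ≤ a) (hab : a ≤ b)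
    (hb : b ≤ T) (hZ : ∀ t ∈ Icc a b, g t ∉ Z) : IsArc φ g a b := by
  have hsub : Icc a b ⊆ Icc 0 T := Icc_subset_Icc ha hb
  have hrefl : IsArc φ g a a := ⟨0, le_rfl, φ.map_zero_apply _, by simp⟩
  suffices Icc a b ⊆ {x | ∀ y ∈ Icc a x, IsArc φ g a y} from this (right_mem_Icc.2 hab) b
    (right_mem_Icc.2 hab)
  refine IsClosed.Icc_subset_of_forall_exists_gt ?_ ?_ ?_
  · refine isClosed_of_closure_subset fun x hx ↦ ?_
    have hxI : x ∈ Icc a b := isClosed_Icc.closure_subset_iff.2 inter_subset_right hx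
    refine ⟨fun y hy ↦ ?_, hxI⟩
    obtain ⟨δ, hδ, hloc⟩ := h x (hsub hxI) (hZ x hxI)
    obtain ⟨x', ⟨hx', hx'I⟩, hd⟩ := Metric.mem_closure_iff.1 hx δ hδ
    rw [dist_comm, Real.dist_eq] at hd
    rcases le_or_gt y x' with hyx | hyx
    · exact hx' y ⟨hy.1, hyx⟩
    · refine (hx' x' ⟨hx'I.1, le_rfl⟩).trans hx'I.1 hyx.le
        (hloc x' (hsub hx'I) y (hsub ⟨hy.1, hy.2.trans hxI.2⟩) hd ?_ hyx.le)
      rw [abs_lt] at hd ⊢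
      constructor <;> linarith [hy.2]
  · intro y hy
    rw [le_antisymm hy.2 hy.1]
    exact hrefl
  · rintro x ⟨hx, hxI⟩ y hy
    obtain ⟨δ, hδ, hloc⟩ := h x (hsub ⟨hxI.1, hxI.2.le⟩) (hZ x ⟨hxI.1, hxI.2.le⟩)
    refine ⟨min (x + δ / 2) (min y b), fun z hz ↦ ?_,
      lt_min (by linarith) (lt_min hy hxI.2), (min_le_right _ _).trans (min_le_left _ _)⟩
    rcases le_or_gt z x with hzx | hzx
    · exact hx z ⟨hz.1, hzx⟩
    · have h1 : z ≤ x + δ / 2 := hz.2.trans (min_le_left _ _)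
      have h2 : z ≤ b := hz.2.trans ((min_le_right _ _).trans (min_le_right _ _))
      refine (hx x ⟨hxI.1, le_rfl⟩).trans hxI.1 hzx.le
        (hloc x (hsub ⟨hxI.1, hxI.2.le⟩) z (hsub ⟨hz.1, h2⟩) (by simpa using hδ) ?_ hzx.le)
      rw [abs_lt]
      constructor <;> linarith

theorem flow_neg_of_eq {s : ℝ} {p q : M} (h : φ s p = q) (t : ℝ) : φ t q = φ (t + s) p := by
  rw [φ.map_add, h]

theorem isCompact_flow_image (φ : Flow ℝ M) (p : M) (a b : ℝ) :
    IsCompact ((fun t ↦ φ t p) '' Icc a b) :=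
  isCompact_Icc.image (φ.continuous continuous_id continuous_const)

variable [T2Space M]

/-- If all the flow times were below `N`, the path would stay in the compact piece `φ_{[-N,0]}` of
the trajectory of `g t₀`. Its limit `g t₁` would lie on that trajectory, and invariance would put `g
t₀` in `Z`. -/
theorem exists_long_arc_left (h : IsLocallyArc φ g Z T) (hg : ContinuousOn g (Icc 0 T))
    (hinv : ∀ t p, φ t p ∈ Z → p ∈ Z) {t₁ t₀ : ℝ} (h1 : 0 ≤ t₁) (h10 : t₁ < t₀) (h0 : t₀ ≤ T)
    (hZ1 : g t₁ ∈ Z) (hZ : ∀ t ∈ Ioc t₁ t₀, g t ∉ Z) (N : ℝ) :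
    ∃ t ∈ Ioc t₁ t₀, ∃ ρ, N ≤ ρ ∧ φ ρ (g t) = g t₀ ∧
      g '' Icc t t₀ = (fun r ↦ φ r (g t)) '' Icc 0 ρ := by
  by_contra! hcon
  have hmem : ∀ᶠ t in 𝓝[>] t₁, g t ∈ (fun r ↦ φ r (g t₀)) '' Icc (-N) 0 := by
    filter_upwards [Ioc_mem_nhdsGT h10] with t ht
    obtain ⟨ρ, hρ, he, him⟩ := h.isArc (h1.trans ht.1.le) ht.2 h0
      (fun r hr ↦ hZ r ⟨ht.1.trans_le hr.1, hr.2⟩)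
    have hN : ρ < N := by
      by_contra! hN
      exact hcon t ht ρ hN he him
    refine ⟨-ρ, ⟨by linarith, by linarith⟩, ?_⟩
    simp only
    rw [← he, flow_neg_apply]
  have hlim : Tendsto g (𝓝[>] t₁) (𝓝 (g t₁)) :=
    ((hg t₁ ⟨h1, h10.le.trans h0⟩).mono_of_mem_nhdsWithin
      (mem_of_superset (Icc_mem_nhdsGT (h10.trans_le h0)) (Icc_subset_Icc_left h1))).tendsto
  obtain ⟨s, -, hs⟩ := (isCompact_flow_image φ (g t₀) (-N) 0).isClosed.mem_of_tendsto hlim hmem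
  refine hZ t₀ ⟨h10, le_rfl⟩ (hinv s _ ?_)
  simp only at hs
  rwa [hs]

theorem exists_long_arc_right (h : IsLocallyArc φ g Z T) (hg : ContinuousOn g (Icc 0 T))
    (hinv : ∀ t p, φ t p ∈ Z → p ∈ Z) {t₀ t₂ : ℝ} (h0 : 0 ≤ t₀) (h02 : t₀ < t₂) (h2 : t₂ ≤ T)
    (hZ2 : g t₂ ∈ Z) (hZ : ∀ t ∈ Ico t₀ t₂, g t ∉ Z) (N : ℝ) :
    ∃ t ∈ Ico t₀ t₂, ∃ ρ, N ≤ ρ ∧ φ ρ (g t₀) = g t ∧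
      g '' Icc t₀ t = (fun r ↦ φ r (g t₀)) '' Icc 0 ρ := by
  by_contra! hcon
  have hmem : ∀ᶠ t in 𝓝[<] t₂, g t ∈ (fun r ↦ φ r (g t₀)) '' Icc 0 N := by
    filter_upwards [Ico_mem_nhdsLT h02] with t ht
    obtain ⟨ρ, hρ, he, him⟩ := h.isArc h0 ht.1 (ht.2.le.trans h2)
      (fun r hr ↦ hZ r ⟨hr.1, hr.2.trans_lt ht.2⟩)
    have hN : ρ < N := by
      by_contra! hN
      exact hcon t ht ρ hN he him
    exact ⟨ρ, ⟨hρ, hN.le⟩, he⟩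
  have hlim : Tendsto g (𝓝[<] t₂) (𝓝 (g t₂)) :=
    ((hg t₂ ⟨h0.trans h02.le, h2⟩).mono_of_mem_nhdsWithin
      (mem_of_superset (Icc_mem_nhdsLT (h0.trans_lt h02)) (Icc_subset_Icc_right h2))).tendsto
  obtain ⟨s, -, hs⟩ := (isCompact_flow_image φ (g t₀) 0 N).isClosed.mem_of_tendsto hlim hmem
  refine hZ t₀ ⟨le_rfl, h02⟩ (hinv s _ ?_)
  simp only at hs
  rwa [hs]

/-- Arbitrarily long arcs exhaust the backward half-trajectory: reaching `Z` takes infinite flow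
time although it takes finite path time. -/
theorem image_Ioc_eq_backward (h : IsLocallyArc φ g Z T) (hg : ContinuousOn g (Icc 0 T))
    (hinv : ∀ t p, φ t p ∈ Z → p ∈ Z) {t₁ t₀ : ℝ} (h1 : 0 ≤ t₁) (h10 : t₁ < t₀) (h0 : t₀ ≤ T)
    (hZ1 : g t₁ ∈ Z) (hZ : ∀ t ∈ Ioc t₁ t₀, g t ∉ Z) :
    g '' Ioc t₁ t₀ = (fun t ↦ φ t (g t₀)) '' Iic 0 := by
  apply Subset.antisymm
  · rintro _ ⟨t, ht, rfl⟩
    obtain ⟨ρ, hρ, he, -⟩ := h.isArc (h1.trans ht.1.le) ht.2 h0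
      (fun r hr ↦ hZ r ⟨ht.1.trans_le hr.1, hr.2⟩)
    refine ⟨-ρ, by simpa using hρ, ?_⟩
    simp only
    rw [← he, flow_neg_apply]
  · rintro _ ⟨s, hs, rfl⟩
    obtain ⟨t, ht, ρ, hρ, he, him⟩ := exists_long_arc_left h hg hinv h1 h10 h0 hZ1 hZ (-s)
    have hmem : φ (s + ρ) (g t) ∈ g '' Icc t t₀ := by
      rw [him]
      exact mem_image_of_mem _ (⟨by linarith, by linarith [show s ≤ 0 from hs]⟩ : s + ρ ∈ Icc 0 ρ)
    simp only
    rw [flow_neg_of_eq he s]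
    exact image_mono (t := Ioc t₁ t₀) (fun r hr ↦ ⟨ht.1.trans_le hr.1, hr.2⟩) hmem

theorem image_Ico_eq_forward (h : IsLocallyArc φ g Z T) (hg : ContinuousOn g (Icc 0 T))
    (hinv : ∀ t p, φ t p ∈ Z → p ∈ Z) {t₀ t₂ : ℝ} (h0 : 0 ≤ t₀) (h02 : t₀ < t₂) (h2 : t₂ ≤ T)
    (hZ2 : g t₂ ∈ Z) (hZ : ∀ t ∈ Ico t₀ t₂, g t ∉ Z) :
    g '' Ico t₀ t₂ = (fun t ↦ φ t (g t₀)) '' Ici 0 := by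
  apply Subset.antisymm
  · rintro _ ⟨t, ht, rfl⟩
    obtain ⟨ρ, hρ, he, -⟩ := h.isArc h0 ht.1 (ht.2.le.trans h2)
      (fun r hr ↦ hZ r ⟨hr.1, hr.2.trans_lt ht.2⟩)
    exact ⟨ρ, hρ, he⟩
  · rintro _ ⟨s, hs, rfl⟩
    obtain ⟨t, ht, ρ, hρ, he, him⟩ := exists_long_arc_right h hg hinv h0 h02 h2 hZ2 hZ s
    have hmem : φ s (g t₀) ∈ g '' Icc t₀ t := by
      rw [him]
      exact ⟨s, ⟨hs, hρ⟩, rfl⟩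
    exact image_mono (t := Ico t₀ t₂) (fun r hr ↦ ⟨hr.1, hr.2.trans_lt ht.2⟩) hmem

theorem tendsto_atBot_of_gap (h : IsLocallyArc φ g Z T) (hg : ContinuousOn g (Icc 0 T))
    (hinv : ∀ t p, φ t p ∈ Z → p ∈ Z) {t₁ t₀ : ℝ} (h1 : 0 ≤ t₁) (h10 : t₁ < t₀) (h0 : t₀ ≤ T)
    (hZ1 : g t₁ ∈ Z) (hZ : ∀ t ∈ Ioc t₁ t₀, g t ∉ Z) :
    Tendsto (fun t ↦ φ t (g t₀)) atBot (𝓝 (g t₁)) := by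
  have hlim : Tendsto g (𝓝[>] t₁) (𝓝 (g t₁)) :=
    ((hg t₁ ⟨h1, h10.le.trans h0⟩).mono_of_mem_nhdsWithin
      (mem_of_superset (Icc_mem_nhdsGT (h10.trans_le h0)) (Icc_subset_Icc_left h1))).tendsto
  intro B hB
  obtain ⟨u, hu, hsub⟩ := (mem_nhdsGT_iff_exists_Ioc_subset).1 (hlim hB)
  -- For `t'` close to `t₁` the path on `(t₁, t']` lies in `B` and is the whole backward
  -- half-trajectory of `g t'`. It remains to shift time by the flow time from `g t'` to `g t₀`.
  set t' := min u t₀ with ht'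
  have h1t : t₁ < t' := lt_min hu h10
  have him := image_Ioc_eq_backward h hg hinv h1 h1t ((min_le_right _ _).trans h0) hZ1
    (fun r hr ↦ hZ r ⟨hr.1, hr.2.trans (min_le_right _ _)⟩)
  obtain ⟨ρ, hρ, he, -⟩ := h.isArc (h1.trans h1t.le) (min_le_right u t₀) h0
    (fun r hr ↦ hZ r ⟨h1t.trans_le hr.1, hr.2⟩)
  refine mem_map.2 (mem_atBot_sets.2 ⟨-ρ, fun s hs ↦ ?_⟩)
  have hmem : φ (s + ρ) (g t') ∈ g '' Ioc t₁ t' := by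
    rw [him]
    exact ⟨s + ρ, by simpa using (by linarith : s + ρ ≤ 0), rfl⟩
  rw [mem_preimage, flow_neg_of_eq he s]
  obtain ⟨r, hr, hre⟩ := hmem
  rw [← hre]
  exact hsub ⟨hr.1, hr.2.trans (min_le_left _ _)⟩

theorem tendsto_atTop_of_gap (h : IsLocallyArc φ g Z T) (hg : ContinuousOn g (Icc 0 T))
    (hinv : ∀ t p, φ t p ∈ Z → p ∈ Z) {t₀ t₂ : ℝ} (h0 : 0 ≤ t₀) (h02 : t₀ < t₂) (h2 : t₂ ≤ T)
    (hZ2 : g t₂ ∈ Z) (hZ : ∀ t ∈ Ico t₀ t₂, g t ∉ Z) :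
    Tendsto (fun t ↦ φ t (g t₀)) atTop (𝓝 (g t₂)) := by
  have hlim : Tendsto g (𝓝[<] t₂) (𝓝 (g t₂)) :=
    ((hg t₂ ⟨h0.trans h02.le, h2⟩).mono_of_mem_nhdsWithin
      (mem_of_superset (Icc_mem_nhdsLT (h0.trans_lt h02)) (Icc_subset_Icc_right h2))).tendsto
  intro B hB
  obtain ⟨u, hu, hsub⟩ := (mem_nhdsLT_iff_exists_Ico_subset).1 (hlim hB)
  set t' := max u t₀ with ht'
  have ht2 : t' < t₂ := max_lt hu h02
  have him := image_Ico_eq_forward h hg hinv (h0.trans (le_max_right u t₀)) ht2 h2 hZ2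
    (fun r hr ↦ hZ r ⟨(le_max_right u t₀).trans hr.1, hr.2⟩)
  obtain ⟨ρ, hρ, he, -⟩ := h.isArc h0 (le_max_right u t₀) (ht2.le.trans h2)
    (fun r hr ↦ hZ r ⟨hr.1, hr.2.trans_lt ht2⟩)
  refine mem_map.2 (mem_atTop_sets.2 ⟨ρ, fun s hs ↦ ?_⟩)
  have hmem : φ (s - ρ) (g t') ∈ g '' Ico t' t₂ := by
    rw [him]
    exact ⟨s - ρ, by simpa using hs, rfl⟩
  rw [mem_preimage, show φ s (g t₀) = φ (s - ρ) (g t') by rw [flow_neg_of_eq he, sub_add_cancel]]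
  obtain ⟨r, hr, hre⟩ := hmem
  rw [← hre]
  exact hsub ⟨(le_max_left u t₀).trans hr.1, hr.2⟩

/-- Cut at the midpoint: the two pieces are the backward and forward halves of the trajectory
through it. -/
theorem gap_trajectory (h : IsLocallyArc φ g Z T) (hg : ContinuousOn g (Icc 0 T))
    (hinv : ∀ t p, φ t p ∈ Z → p ∈ Z) {a b : ℝ} (ha : 0 ≤ a) (hab : a < b) (hb : b ≤ T)
    (hZa : g a ∈ Z) (hZb : g b ∈ Z) (hZ : ∀ t ∈ Ioo a b, g t ∉ Z) :
    ∃ c ∉ Z, Tendsto (fun t ↦ φ t c) atBot (𝓝 (g a)) ∧ Tendsto (fun t ↦ φ t c) atTop (𝓝 (g b)) ∧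
      g '' Ioo a b = range fun t ↦ φ t c := by
  have hm1 : a < (a + b) / 2 := by linarith
  have hm2 : (a + b) / 2 < b := by linarith
  have hl : ∀ t ∈ Ioc a ((a + b) / 2), g t ∉ Z := fun t ht ↦ hZ t ⟨ht.1, ht.2.trans_lt hm2⟩
  have hr : ∀ t ∈ Ico ((a + b) / 2) b, g t ∉ Z := fun t ht ↦ hZ t ⟨hm1.trans_le ht.1, ht.2⟩
  refine ⟨g ((a + b) / 2), hZ _ ⟨hm1, hm2⟩, tendsto_atBot_of_gap h hg hinv ha hm1 (hm2.le.trans hb) hZa hl,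
    tendsto_atTop_of_gap h hg hinv (ha.trans hm1.le) hm2 hb hZb hr, ?_⟩
  rw [← Ioc_union_Ico_eq_Ioo hm1 hm2, image_union,
    image_Ioc_eq_backward h hg hinv ha hm1 (hm2.le.trans hb) hZa hl,
    image_Ico_eq_forward h hg hinv (ha.trans hm1.le) hm2 hb hZb hr, ← image_union, Iic_union_Ici,
    image_univ]

end Arcs

/-! ### Excursions away from a closed set. -/

section Gaps

variable {M : Type*} [TopologicalSpace M] {g : ℝ → M} {Z : Set M} {T : ℝ}

theorem isCompact_Icc_inter_preimage (hg : ContinuousOn g (Icc 0 T)) (hZ : IsClosed Z) :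
    IsCompact (Icc 0 T ∩ g ⁻¹' Z) :=
  isCompact_Icc.of_isClosed_subset (hg.preimage_isClosed_of_isClosed isClosed_Icc hZ)
    inter_subset_left

theorem exists_gap (hg : ContinuousOn g (Icc 0 T)) (hZ : IsClosed Z) {t₁ t₂ w : ℝ} (h1 : 0 ≤ t₁)
    (h2 : t₂ ≤ T) (hw : w ∈ Icc t₁ t₂) (hZ1 : g t₁ ∈ Z) (hZ2 : g t₂ ∈ Z) (hwZ : g w ∉ Z) :
    ∃ a b, t₁ ≤ a ∧ a < w ∧ w < b ∧ b ≤ t₂ ∧ g a ∈ Z ∧ g b ∈ Z ∧ ∀ t ∈ Ioo a b, g t ∉ Z := by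
  have hK := isCompact_Icc_inter_preimage hg hZ
  have h02 : t₁ ≤ t₂ := hw.1.trans hw.2
  obtain ⟨a, ⟨⟨haI, haZ⟩, haw⟩, hamax⟩ := (hK.inter_right (isClosed_Iic (a := w))).exists_isGreatest
    ⟨t₁, ⟨⟨h1, h02.trans h2⟩, hZ1⟩, hw.1⟩
  obtain ⟨b, ⟨⟨hbI, hbZ⟩, hbw⟩, hbmin⟩ := (hK.inter_right (isClosed_Ici (a := w))).exists_isLeast
    ⟨t₂, ⟨⟨h1.trans h02, h2⟩, hZ2⟩, hw.2⟩
  refine ⟨a, b, hamax ⟨⟨⟨h1, h02.trans h2⟩, hZ1⟩, hw.1⟩, lt_of_le_of_ne haw ?_,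
    lt_of_le_of_ne hbw ?_, hbmin ⟨⟨⟨h1.trans h02, h2⟩, hZ2⟩, hw.2⟩, haZ, hbZ, ?_⟩
  · rintro rfl
    exact hwZ haZ
  · rintro rfl
    exact hwZ hbZ
  · intro t ht htZ
    have htI : t ∈ Icc 0 T := ⟨haI.1.trans ht.1.le, ht.2.le.trans hbI.2⟩
    rcases le_total t w with htw | htw
    · exact ht.1.not_ge (hamax ⟨⟨htI, htZ⟩, htw⟩)
    · exact ht.2.not_ge (hbmin ⟨⟨htI, htZ⟩, htw⟩)

/-- The times spent in `F` and in `Z` are disjoint compact sets, hence a positive distance apart,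
and each gap contains a time of the first kind and has its ends of the second. -/
theorem exists_gap_length_pos (hg : ContinuousOn g (Icc 0 T)) (hZ : IsClosed Z) {F : Set M}
    (hF : IsClosed F) (hFZ : Disjoint F Z)
    (hgap : ∀ a b, 0 ≤ a → a < b → b ≤ T → g a ∈ Z → g b ∈ Z → (∀ t ∈ Ioo a b, g t ∉ Z) →
      ∃ t ∈ Ioo a b, g t ∈ F) :
    ∃ δ > 0, ∀ a b, 0 ≤ a → a < b → b ≤ T → g a ∈ Z → g b ∈ Z → (∀ t ∈ Ioo a b, g t ∉ Z) →
      δ ≤ b - a := by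
  obtain ⟨r, hr, h⟩ := Metric.exists_pos_forall_lt_edist (isCompact_Icc_inter_preimage hg hF)
    (isCompact_Icc_inter_preimage hg hZ).isClosed
    (Set.disjoint_left.2 fun t h1 h2 ↦ Set.disjoint_left.1 hFZ h1.2 h2.2)
  refine ⟨r, hr, fun a b ha hab hb hZa hZb hZt ↦ ?_⟩
  obtain ⟨t, ht, htF⟩ := hgap a b ha hab hb hZa hZb hZt
  have h1 := h t ⟨⟨ha.trans ht.1.le, ht.2.le.trans hb⟩, htF⟩ a ⟨⟨ha, hab.le.trans hb⟩, hZa⟩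
  rw [edist_nndist, ENNReal.coe_lt_coe, ← NNReal.coe_lt_coe, coe_nndist, Real.dist_eq,
    abs_of_pos (sub_pos.2 ht.1)] at h1
  linarith [ht.2]

end Gaps

/-! ### Assembling the excursions into a separatrix path. -/

section Chains

variable {M : Type*} [TopologicalSpace M] [ChartedSpace (EuclideanSpace ℝ (Fin 2)) M]
  [IsManifold (𝓡 2) ∞ M] {Ω : AreaForm M} {X : (x : M) → TangentSpace (𝓡 2) x} {φ : Flow ℝ M}

/-- `A` is the union of a chain of saddles from `p` to `q` and of trajectories connecting them. -/
inductive SaddleChain (φ : Flow ℝ M) (Ω : AreaForm M) (X : (x : M) → TangentSpace (𝓡 2) x) :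
    M → M → Set M → Prop
  | nil {p : M} (hp : IsSaddle Ω X p) : SaddleChain φ Ω X p p {p}
  | cons {p q r c : M} {A : Set M} (hp : IsSaddle Ω X p) (hc : c ∉ fixedPts X)
    (hbot : Tendsto (fun t : ℝ ↦ φ t c) atBot (𝓝 p))
    (htop : Tendsto (fun t : ℝ ↦ φ t c) atTop (𝓝 q)) (h : SaddleChain φ Ω X q r A) :
    SaddleChain φ Ω X p r ({p} ∪ range (fun t : ℝ ↦ φ t c) ∪ A)

namespace SaddleChain

variable {p q r : M} {A B : Set M}

theorem left_mem (h : SaddleChain φ Ω X p q A) : p ∈ A := by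
  cases h <;> simp

theorem right_mem (h : SaddleChain φ Ω X p q A) : q ∈ A := by
  induction h with
  | nil hp => rfl
  | cons hp hc hbot htop h ih => exact Or.inr ih

theorem trans (h : SaddleChain φ Ω X p q A) (h' : SaddleChain φ Ω X q r B) :
    SaddleChain φ Ω X p r (A ∪ B) := by
  induction h with
  | nil hp => rwa [union_eq_self_of_subset_left (singleton_subset_iff.2 h'.left_mem)]
  | cons hp hc hbot htop h ih =>
    rw [union_assoc]
    exact cons hp hc hbot htop (ih h')

theorem exists_fin (h : SaddleChain φ Ω X p q A) :
    ∃ (n : ℕ) (S : Fin (n + 1) → M) (c : Fin n → M), S 0 = p ∧ S (Fin.last n) = q ∧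
      (∀ i, IsSaddle Ω X (S i)) ∧
      (∀ i : Fin n, c i ∉ fixedPts X ∧
        Tendsto (fun t : ℝ ↦ φ t (c i)) atBot (𝓝 (S i.castSucc)) ∧
        Tendsto (fun t : ℝ ↦ φ t (c i)) atTop (𝓝 (S i.succ))) ∧
      A = range S ∪ ⋃ i, range (fun t : ℝ ↦ φ t (c i)) := by
  induction h with
  | nil hp => exact ⟨0, fun _ ↦ _, Fin.elim0, rfl, rfl, fun _ ↦ hp, fun i ↦ i.elim0, by simp⟩
  | @cons p q r c A hp hc hbot htop h ih =>
    obtain ⟨n, S, d, h0, hl, hS, hd, hA⟩ := ih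
    refine ⟨n + 1, Fin.cons p S, Fin.cons c d, rfl, by rw [← Fin.succ_last, Fin.cons_succ, hl],
      Fin.cases hp hS, fun i ↦ ?_, ?_⟩
    · refine Fin.cases ⟨hc, hbot, ?_⟩ (fun i ↦ ?_) i
      · rwa [Fin.cons_zero, Fin.cons_succ, h0]
      · rw [← Fin.succ_castSucc, Fin.cons_succ, Fin.cons_succ, Fin.cons_succ]
        exact hd i
    · ext x
      rw [hA, Fin.range_cons]
      simp only [mem_union, mem_insert_iff, mem_singleton_iff, mem_iUnion, Fin.exists_fin_succ,
        Fin.cons_zero, Fin.cons_succ]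
      tauto

end SaddleChain

/-- Either a single point, or a chain of saddles. -/
def IsPointOrChain (φ : Flow ℝ M) (Ω : AreaForm M) (X : (x : M) → TangentSpace (𝓡 2) x)
    (p q : M) (A : Set M) : Prop :=
  (p = q ∧ A = {p}) ∨ SaddleChain φ Ω X p q A

theorem IsPointOrChain.trans {p q r : M} {A B : Set M} (h : IsPointOrChain φ Ω X p q A)
    (h' : IsPointOrChain φ Ω X q r B) : IsPointOrChain φ Ω X p r (A ∪ B) := by
  rcases h with ⟨rfl, rfl⟩ | h <;> rcases h' with ⟨rfl, rfl⟩ | h'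
  · exact Or.inl ⟨rfl, union_self _⟩
  · rw [union_eq_self_of_subset_left (singleton_subset_iff.2 h'.left_mem)]
    exact Or.inr h'
  · rw [union_eq_self_of_subset_right (singleton_subset_iff.2 h.right_mem)]
    exact Or.inr h
  · exact Or.inr (h.trans h')

/-- `F` consists of one non-fixed point chosen on each separatrix. It is what converts finiteness of
separatrices into a minimal gap length. -/
theorem exists_finite_transversal_separatrices
    (hsep : {σ : Set M | IsStableSeparatrix φ X σ ∨ IsUnstableSeparatrix φ X σ}.Finite) :
    ∃ F : Set M, F.Finite ∧ Disjoint F (fixedPts X) ∧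
      ∀ c ∉ fixedPts X, ∀ p ∈ fixedPts X, Tendsto (fun t : ℝ ↦ φ t c) atTop (𝓝 p) →
        ∃ x ∈ F, x ∈ range fun t : ℝ ↦ φ t c := by
  have : ∀ σ : {σ : Set M | IsStableSeparatrix φ X σ ∨ IsUnstableSeparatrix φ X σ},
      ∃ x : M, x ∉ fixedPts X ∧ x ∈ σ.1 := by
    rintro ⟨σ, ⟨x, hx, rfl, -⟩ | ⟨x, hx, rfl, -⟩⟩ <;> exact ⟨x, hx, 0, φ.map_zero_apply x⟩
  choose f hf using this
  have := hsep.to_subtype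
  refine ⟨range f, finite_range f, ?_, ?_⟩
  · rw [Set.disjoint_left]
    rintro _ ⟨σ, rfl⟩
    exact (hf σ).1
  · intro c hc p hp hlim
    have hσ : IsStableSeparatrix φ X (range fun t : ℝ ↦ φ t c) := ⟨c, hc, rfl, p, hp, hlim⟩
    exact ⟨_, mem_range_self ⟨_, Or.inl hσ⟩, (hf ⟨_, Or.inl hσ⟩).2⟩

variable [T2Space M] {g : ℝ → M} {T : ℝ}

theorem saddleChain_of_gap (hX : IsSmoothField X) (hφ : IsSmoothFlowOf φ X)
    (hφΩ : PreservesArea φ Ω) (hg : ContinuousOn g (Icc 0 T))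
    (h : IsLocallyArc φ g (fixedPts X) T) {a b : ℝ} (ha : 0 ≤ a) (hab : a < b) (hb : b ≤ T)
    (hZa : g a ∈ fixedPts X) (hZb : g b ∈ fixedPts X) (hZ : ∀ t ∈ Ioo a b, g t ∉ fixedPts X) :
    SaddleChain φ Ω X (g a) (g b) (g '' Icc a b) := by
  obtain ⟨c, hc, hbot, htop, him⟩ := gap_trajectory h hg
    (fun t p ↦ (flow_mem_fixedPts_iff hX hφ).1) ha hab hb hZa hZb hZ
  have := SaddleChain.cons (isSaddle_of_tendsto_atBot hX hφ hφΩ hZa hc hbot) hc hbot htop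
    (SaddleChain.nil (isSaddle_of_tendsto_atTop hX hφ hφΩ hZb hc htop))
  rwa [← him, ← image_singleton, ← image_singleton, ← image_union, ← image_union,
    singleton_union, Ioo_insert_left hab, union_singleton, Ico_insert_right hab.le] at this

/-- Bisection on the duration. Below `δ` no gap fits, so `g` takes values in a finite set and is
constant. Otherwise split at the midpoint if it is mapped to a fixed point; if not, split off the
gap around it, which leaves two intervals of less than half the length. -/
theorem isPointOrChain_of_lt (hX : IsSmoothField X) (hφ : IsSmoothFlowOf φ X)
    (hφΩ : PreservesArea φ Ω) (hfix : (fixedPts X).Finite) (hg : ContinuousOn g (Icc 0 T))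
    (h : IsLocallyArc φ g (fixedPts X) T) {δ : ℝ}
    (hδ : ∀ a b, 0 ≤ a → a < b → b ≤ T → g a ∈ fixedPts X → g b ∈ fixedPts X →
      (∀ t ∈ Ioo a b, g t ∉ fixedPts X) → δ ≤ b - a) (n : ℕ) :
    ∀ t₁ t₂, 0 ≤ t₁ → t₁ ≤ t₂ → t₂ ≤ T → g t₁ ∈ fixedPts X → g t₂ ∈ fixedPts X →
      t₂ - t₁ < 2 ^ n * δ → IsPointOrChain φ Ω X (g t₁) (g t₂) (g '' Icc t₁ t₂) := by
  induction n with
  | zero =>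
    intro t₁ t₂ h1 h12 h2 hZ1 hZ2 hlt
    have hmaps : MapsTo g (Icc t₁ t₂) (fixedPts X) := by
      intro w hw
      by_contra hwZ
      obtain ⟨a, b, hta, haw, hwb, hbt, hZa, hZb, hZ⟩ :=
        exists_gap hg hfix.isClosed h1 h2 hw hZ1 hZ2 hwZ
      have := hδ a b (h1.trans hta) (haw.trans hwb) (hbt.trans h2) hZa hZb hZ
      linarith
    obtain ⟨y, -, hy⟩ := isPreconnected_Icc.eqOn_const_of_mapsTo hfix.isDiscrete
      (hg.mono (Icc_subset_Icc h1 h2)) hmaps ⟨_, hZ1⟩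
    have e1 : g t₁ = y := hy (left_mem_Icc.2 h12)
    have e2 : g t₂ = y := hy (right_mem_Icc.2 h12)
    refine Or.inl ⟨e1.trans e2.symm, ?_⟩
    rw [e1, hy.image_eq]
    exact (nonempty_Icc.2 h12).image_const y
  | succ n ih =>
    intro t₁ t₂ h1 h12 h2 hZ1 hZ2 hlt
    rw [pow_succ] at hlt
    have hm : (t₁ + t₂) / 2 ∈ Icc t₁ t₂ := ⟨by linarith, by linarith⟩
    by_cases hmZ : g ((t₁ + t₂) / 2) ∈ fixedPts X
    · rw [← Icc_union_Icc_eq_Icc hm.1 hm.2, image_union]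
      exact (ih _ _ h1 hm.1 (hm.2.trans h2) hZ1 hmZ (by linarith)).trans
        (ih _ _ (h1.trans hm.1) hm.2 h2 hmZ hZ2 (by linarith))
    · obtain ⟨a, b, hta, haw, hwb, hbt, hZa, hZb, hZ⟩ :=
        exists_gap hg hfix.isClosed h1 h2 hm hZ1 hZ2 hmZ
      have hab := haw.trans hwb
      rw [← Icc_union_Icc_eq_Icc (hta.trans hab.le) hbt, ← Icc_union_Icc_eq_Icc hta hab.le,
        image_union, image_union]
      exact ((ih _ _ h1 hta (hab.le.trans (hbt.trans h2)) hZ1 hZa (by linarith)).trans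
        (Or.inr (saddleChain_of_gap hX hφ hφΩ hg h (h1.trans hta) hab (hbt.trans h2) hZa hZb
          hZ))).trans (ih _ _ (h1.trans (hta.trans hab.le)) hbt h2 hZb hZ2 (by linarith))

/-- Between the first visit `t₁` and the last visit `t₂` the path is a point or a chain; before and
after, it is a half-trajectory or empty. -/
theorem isSeparatrixPath_or_singleton (hX : IsSmoothField X) (hφ : IsSmoothFlowOf φ X)
    (hφΩ : PreservesArea φ Ω) (hfix : (fixedPts X).Finite)
    (hsep : {σ : Set M | IsStableSeparatrix φ X σ ∨ IsUnstableSeparatrix φ X σ}.Finite)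
    (hg : ContinuousOn g (Icc 0 T)) (h : IsLocallyArc φ g (fixedPts X) T)
    (hne : ∃ t ∈ Icc 0 T, g t ∈ fixedPts X) :
    IsSeparatrixPath φ Ω X (g '' Icc 0 T) ∨ ∃ p ∈ fixedPts X, g '' Icc 0 T = {p} := by
  have hinv : ∀ t p, φ t p ∈ fixedPts X → p ∈ fixedPts X :=
    fun t p ↦ (flow_mem_fixedPts_iff hX hφ).1
  obtain ⟨F, hFfin, hFZ, hF⟩ := exists_finite_transversal_separatrices hsep
  obtain ⟨δ, hδ, hgap⟩ := exists_gap_length_pos hg hfix.isClosed hFfin.isClosed hFZ (by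
    intro a b ha hab hb hZa hZb hZ
    obtain ⟨c, hc, -, htop, him⟩ := gap_trajectory h hg hinv ha hab hb hZa hZb hZ
    obtain ⟨x, hxF, hx⟩ := hF c hc _ hZb htop
    rw [← him] at hx
    obtain ⟨t, ht, rfl⟩ := hx
    exact ⟨t, ht, hxF⟩)
  have hK := isCompact_Icc_inter_preimage hg hfix.isClosed
  obtain ⟨t₁, ⟨ht1, hZ1⟩, hmin⟩ := hK.exists_isLeast hne
  obtain ⟨t₂, ⟨ht2, hZ2⟩, hmax⟩ := hK.exists_isGreatest hne
  have h12 : t₁ ≤ t₂ := hmin ⟨ht2, hZ2⟩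
  have hl : ∀ t ∈ Ico 0 t₁, g t ∉ fixedPts X := fun t ht hZ ↦
    ht.2.not_ge (hmin ⟨⟨ht.1, ht.2.le.trans ht1.2⟩, hZ⟩)
  have hr : ∀ t ∈ Ioc t₂ T, g t ∉ fixedPts X := fun t ht hZ ↦
    ht.1.not_ge (hmax ⟨⟨ht2.1.trans ht.1.le, ht.2⟩, hZ⟩)
  have hleft : (t₁ = 0 ∧ (fun t ↦ φ t (g 0)) '' Ici 0 = {g 0}) ∨ (IsSaddle Ω X (g t₁) ∧
      g 0 ∉ fixedPts X ∧ Tendsto (fun t ↦ φ t (g 0)) atTop (𝓝 (g t₁)) ∧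
      (fun t ↦ φ t (g 0)) '' Ici 0 = g '' Ico 0 t₁) := by
    rcases ht1.1.eq_or_lt with h0 | h0
    · refine Or.inl ⟨h0.symm, ?_⟩
      rw [image_congr (fun t _ ↦ flow_eq_of_mem_fixedPts hX hφ (h0 ▸ hZ1) t)]
      exact nonempty_Ici.image_const _
    · have hlim := tendsto_atTop_of_gap h hg hinv le_rfl h0 ht1.2 hZ1 hl
      have h00 := hl 0 ⟨le_rfl, h0⟩
      exact Or.inr ⟨isSaddle_of_tendsto_atTop hX hφ hφΩ hZ1 h00 hlim, h00, hlim,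
        (image_Ico_eq_forward h hg hinv le_rfl h0 ht1.2 hZ1 hl).symm⟩
  have hright : (t₂ = T ∧ (fun t ↦ φ t (g T)) '' Iic 0 = {g T}) ∨ (IsSaddle Ω X (g t₂) ∧
      g T ∉ fixedPts X ∧ Tendsto (fun t ↦ φ t (g T)) atBot (𝓝 (g t₂)) ∧
      (fun t ↦ φ t (g T)) '' Iic 0 = g '' Ioc t₂ T) := by
    rcases ht2.2.eq_or_lt with h0 | h0
    · refine Or.inl ⟨h0, ?_⟩
      rw [image_congr (fun t _ ↦ flow_eq_of_mem_fixedPts hX hφ (h0 ▸ hZ2) t)]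
      exact nonempty_Iic.image_const _
    · have hlim := tendsto_atBot_of_gap h hg hinv ht2.1 h0 le_rfl hZ2 hr
      have h00 := hr T ⟨h0, le_rfl⟩
      exact Or.inr ⟨isSaddle_of_tendsto_atBot hX hφ hφΩ hZ2 h00 hlim, h00, hlim,
        (image_Ioc_eq_backward h hg hinv ht2.1 h0 le_rfl hZ2 hr).symm⟩
  obtain ⟨n, hn⟩ := pow_unbounded_of_one_lt ((t₂ - t₁) / δ) one_lt_two
  rw [div_lt_iff₀ hδ] at hn
  have hmid := isPointOrChain_of_lt hX hφ hφΩ hfix hg h hgap n t₁ t₂ ht1.1 h12 ht2.2 hZ1 hZ2 hn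
  have hpath : SaddleChain φ Ω X (g t₁) (g t₂) (g '' Icc t₁ t₂) →
      IsSeparatrixPath φ Ω X (g '' Icc 0 T) := by
    intro hchain
    obtain ⟨n, S, c, h0, hlast, hS, hc, hA⟩ := hchain.exists_fin
    refine ⟨n, g 0, g T, S, c, hS, ?_, hc, ?_, ?_⟩
    · rw [h0]
      rcases hleft with ⟨h, -⟩ | ⟨-, h, h', -⟩
      · exact Or.inl (by rw [h])
      · exact Or.inr ⟨h, h'⟩
    · rw [hlast]
      rcases hright with ⟨h, -⟩ | ⟨-, h, h', -⟩
      · exact Or.inl (by rw [h])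
      · exact Or.inr ⟨h, h'⟩
    · rw [union_assoc (_ '' Ici 0), ← hA]
      have e1 : (fun t ↦ φ t (g 0)) '' Ici 0 ∪ g '' Icc t₁ t₂ = g '' Icc 0 t₂ := by
        rcases hleft with ⟨h, h'⟩ | ⟨-, -, -, h'⟩
        · rw [h', h]
          exact union_eq_self_of_subset_left (singleton_subset_iff.2
            (mem_image_of_mem g (left_mem_Icc.2 (h ▸ h12))))
        · rw [h', ← image_union, Ico_union_Icc_eq_Icc ht1.1 h12]
      rw [e1]
      rcases hright with ⟨h, h'⟩ | ⟨-, -, -, h'⟩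
      · rw [h', h]
        exact (union_eq_self_of_subset_right (singleton_subset_iff.2
          (mem_image_of_mem g (right_mem_Icc.2 (h ▸ ht2.1))))).symm
      · rw [h', ← image_union, Icc_union_Ioc_eq_Icc ht2.1 ht2.2]
  -- When the middle part is a single point, any nontrivial end piece forces this point to be a
  -- saddle, that is, a chain without connections. Without end pieces the limit is one fixed point.
  rcases hmid with ⟨heq, him⟩ | hchain
  · rcases hleft with ⟨h0, -⟩ | ⟨hs, -⟩
    · rcases hright with ⟨hT, -⟩ | ⟨hs, -⟩
      · refine Or.inr ⟨g t₁, hZ1, ?_⟩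
        rw [← him, h0, hT]
      · refine Or.inl (hpath ?_)
        rw [him, heq]
        exact .nil hs
    · refine Or.inl (hpath ?_)
      rw [him, ← heq]
      exact .nil hs
  · exact Or.inl (hpath hchain)

end Chains

/-! ### The orthogonal flow: maximal time, continuity, order. -/

section OrthogonalFlow

variable {M : Type*} [EMetricSpace M] [ChartedSpace (EuclideanSpace ℝ (Fin 2)) M]
  [IsManifold (𝓡 2) ∞ M] [Bundle.RiemannianBundle (fun x : M ↦ TangentSpace (𝓡 2) x)]
  {Ω : AreaForm M} {X : (x : M) → TangentSpace (𝓡 2) x} {φ : Flow ℝ M}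

theorem OrthFlowTo.notMem_fixedPts {s : ℝ} {p q : M} (h : OrthFlowTo Ω X s p q) (hs : 0 ≤ s) :
    q ∉ fixedPts X := by
  obtain ⟨β, -, rfl, hreg, -⟩ := h
  exact hreg s ⟨hs, le_rfl⟩

theorem OrthDefinedOn.mono {s s' : ℝ} {A : Set M} (h : OrthDefinedOn Ω X s A) (hs : s' ∈ Icc 0 s) :
    OrthDefinedOn Ω X s' A := by
  intro p hp
  obtain ⟨q, β, h0, -, hreg, hβ⟩ := h p hp
  exact ⟨β s', β, h0, rfl, fun r hr ↦ hreg r ⟨hr.1, hr.2.trans hs.2⟩,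
    hβ.mono (Icc_subset_Icc_right hs.2)⟩

variable [IsContMDiffRiemannianBundle (𝓡 2) ∞ (EuclideanSpace ℝ (Fin 2))
      (fun x : M ↦ TangentSpace (𝓡 2) x)]

theorem OrthFlowTo.eqOn (hX : IsSmoothField X) {s : ℝ} {p : M} {β β' : ℝ → M}
    (hreg : ∀ r ∈ Icc 0 s, β r ∉ fixedPts X)
    (hβ : IsMIntegralCurveOn (I := 𝓡 2) β (orthField Ω X) (Icc 0 s)) (h0 : β 0 = p)
    (hβ' : IsMIntegralCurveOn (I := 𝓡 2) β' (orthField Ω X) (Icc 0 s)) (h0' : β' 0 = p) :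
    EqOn β β' (Icc 0 s) :=
  eqOn_Icc_of_isC1At hβ hβ' (h0.trans h0'.symm) fun r hr ↦ isC1At_orthField hX (hreg r hr)

theorem OrthFlowTo.unique (hX : IsSmoothField X) {s : ℝ} (hs : 0 ≤ s) {p q q' : M}
    (h : OrthFlowTo Ω X s p q) (h' : OrthFlowTo Ω X s p q') : q = q' := by
  obtain ⟨β, h0, rfl, hreg, hβ⟩ := h
  obtain ⟨β', h0', rfl, -, hβ'⟩ := h'
  exact OrthFlowTo.eqOn hX hreg hβ h0 hβ' h0' ⟨hs, le_rfl⟩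

theorem orthFlowTo_zero (hX : IsSmoothField X) {p : M} (hp : p ∉ fixedPts X) :
    OrthFlowTo Ω X 0 p p := by
  obtain ⟨α, hα, hαv⟩ :=
    exists_isMIntegralCurveAt_of_contMDiffAt_boundaryless 0 (isC1At_orthField (Ω := Ω) hX hp)
  rw [isMIntegralCurveAt_iff'] at hαv
  obtain ⟨ε, hε, hα'⟩ := hαv
  refine ⟨α, hα, hα, fun r hr ↦ ?_, hα'.mono fun r hr ↦ ?_⟩
  · rw [le_antisymm hr.2 hr.1, hα]
    exact hp
  · rw [le_antisymm hr.2 hr.1]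
    exact Metric.mem_ball_self hε

theorem OrthFlowTo.exists_extension (hX : IsSmoothField X) (hZ : IsClosed (fixedPts X)) {s : ℝ}
    (hs : 0 ≤ s) {p q : M} (h : OrthFlowTo Ω X s p q) :
    ∃ ε > 0, ∃ q', OrthFlowTo Ω X (s + ε) p q' := by
  obtain ⟨β, h0, rfl, hreg, hβ⟩ := h
  have hsI : s ∈ Icc 0 s := ⟨hs, le_rfl⟩
  obtain ⟨ε, hε, γ, hγβ, hγ⟩ := exists_extension_of_isC1At hs hβ (isC1At_orthField hX (hreg s hsI))
  have hcont : ContinuousWithinAt γ (Icc 0 (s + ε)) s := hγ.continuousOn s ⟨hs, by linarith⟩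
  have hev : ∀ᶠ r in 𝓝[Icc 0 (s + ε)] s, γ r ∉ fixedPts X := by
    refine hcont.eventually (hZ.isOpen_compl.mem_nhds ?_)
    rw [mem_compl_iff, hγβ hsI]
    exact hreg s hsI
  obtain ⟨δ, hδ, hsub⟩ := Metric.mem_nhdsWithin_iff.1 hev
  refine ⟨min ε (δ / 2), by positivity, γ (s + min ε (δ / 2)), γ,
    (hγβ ⟨le_rfl, hs⟩).trans h0, rfl, fun r hr ↦ ?_,
    hγ.mono (Icc_subset_Icc_right (by linarith [min_le_left ε (δ / 2)]))⟩
  rcases le_total r s with hrs | hrs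
  · rw [hγβ ⟨hr.1, hrs⟩]
    exact hreg r ⟨hr.1, hrs⟩
  · refine hsub ⟨?_, hr.1, hr.2.trans (by linarith [min_le_left ε (δ / 2)])⟩
    rw [Metric.mem_ball, Real.dist_eq, abs_of_nonneg (sub_nonneg.2 hrs)]
    linarith [hr.2, min_le_right ε (δ / 2)]

theorem OrthFlowTo.exists_strip (hX : IsSmoothField X) (hφ : IsSmoothFlowOf φ X)
    (hφΩ : PreservesArea φ Ω) {s : ℝ} (hs : 0 ≤ s) {p q : M} (h : OrthFlowTo Ω X s p q) :
    ∃ δ > 0, ∃ θ : ℝ → ℝ, Monotone θ ∧ Continuous θ ∧ θ 0 = 0 ∧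
      ∀ t, |t| < δ → OrthFlowTo Ω X s (φ t p) (φ (θ t) q) := by
  obtain ⟨β, rfl, rfl, hreg, hβ⟩ := h
  obtain ⟨δ, hδ, θ, hθ0, h0θ, hmono, hcont, hθ⟩ := SurfaceFlow.exists_strip hX hφ hφΩ hs hβ hreg
  have hsI : s ∈ Icc 0 s := ⟨hs, le_rfl⟩
  refine ⟨δ, hδ, fun t ↦ θ t s, hmono s hsI, hcont s hsI, h0θ s hsI, fun t ht ↦
    ⟨fun r ↦ φ (θ t r) (β r), by simp only [hθ0], rfl, fun r hr ↦ ?_, hθ t ht⟩⟩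
  rw [flow_mem_fixedPts_iff hX hφ]
  exact hreg r hr

/-- Extend one orthogonal trajectory past time `s`; the strip around the extended trajectory then
extends its neighbours by the same amount, and compactness of `[0, T]` gives a common `ε`. -/
theorem OrthDefinedOn.exists_extension (hX : IsSmoothField X) (hφ : IsSmoothFlowOf φ X)
    (hφΩ : PreservesArea φ Ω) (hZ : IsClosed (fixedPts X)) {s T : ℝ} (hs : 0 ≤ s) {x₀ : M}
    (h : OrthDefinedOn Ω X s (trajSegment φ x₀ T)) :
    ∃ ε > 0, OrthDefinedOn Ω X (s + ε) (trajSegment φ x₀ T) := by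
  suffices ∃ ε > 0, OrthDefinedOn Ω X (s + ε) ((fun t ↦ φ t x₀) '' Icc 0 T) from this
  refine isCompact_Icc.induction_on
    (p := fun A ↦ ∃ ε > 0, OrthDefinedOn Ω X (s + ε) ((fun t ↦ φ t x₀) '' A)) ?_ ?_ ?_ ?_
  · exact ⟨1, one_pos, fun p hp ↦ by simp at hp⟩
  · rintro A B hAB ⟨ε, hε, hB⟩
    exact ⟨ε, hε, fun p hp ↦ hB p (image_mono hAB hp)⟩
  · rintro A B ⟨ε, hε, hA⟩ ⟨ε', hε', hB⟩
    refine ⟨min ε ε', lt_min hε hε', ?_⟩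
    rw [image_union]
    have h0 : 0 ≤ s + min ε ε' := add_nonneg hs (le_min hε.le hε'.le)
    rintro p (hp | hp)
    · exact hA.mono ⟨h0, by gcongr; exact min_le_left _ _⟩ p hp
    · exact hB.mono ⟨h0, by gcongr; exact min_le_right _ _⟩ p hp
  · intro t ht
    obtain ⟨q, hq⟩ := h (φ t x₀) (mem_image_of_mem _ ht)
    obtain ⟨ε, hε, q', hq'⟩ := hq.exists_extension hX hZ hs
    obtain ⟨δ, hδ, θ, -, -, -, hθ⟩ := hq'.exists_strip hX hφ hφΩ (by linarith)
    refine ⟨Metric.ball t δ, mem_nhdsWithin_of_mem_nhds (Metric.ball_mem_nhds t hδ), ε, hε, ?_⟩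
    rintro _ ⟨t', ht', rfl⟩
    have := hθ (t' - t) ht'
    rw [← φ.map_add, sub_add_cancel] at this
    exact ⟨_, this⟩

theorem exists_maximal_time (hX : IsSmoothField X) (hφ : IsSmoothFlowOf φ X)
    (hφΩ : PreservesArea φ Ω) (hZ : IsClosed (fixedPts X)) {x₀ : M} (hx₀ : x₀ ∉ fixedPts X) {T : ℝ}
    (h : ¬ ∀ s : ℝ, 0 < s → OrthDefinedOn Ω X s (trajSegment φ x₀ T)) :
    ∃ S : ℝ, 0 < S ∧ (∀ s ∈ Ico 0 S, OrthDefinedOn Ω X s (trajSegment φ x₀ T)) ∧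
      ¬ OrthDefinedOn Ω X S (trajSegment φ x₀ T) := by
  push Not at h
  obtain ⟨s₁, hs₁, hbad⟩ := h
  set A := {s : ℝ | 0 ≤ s ∧ OrthDefinedOn Ω X s (trajSegment φ x₀ T)} with hA
  have h0 : (0 : ℝ) ∈ A := by
    refine ⟨le_rfl, ?_⟩
    rintro _ ⟨t, -, rfl⟩
    exact ⟨_, orthFlowTo_zero hX (by rwa [flow_mem_fixedPts_iff hX hφ])⟩
  have hbdd : BddAbove A := by
    refine ⟨s₁, fun s hs ↦ ?_⟩
    by_contra! hlt
    exact hbad (hs.2.mono ⟨hs₁.le, hlt.le⟩)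
  have hext : ∀ s ∈ A, s < sSup A := by
    intro s hs
    obtain ⟨ε, hε, hdef⟩ := hs.2.exists_extension hX hφ hφΩ hZ hs.1
    exact (lt_add_of_pos_right s hε).trans_le (le_csSup hbdd ⟨add_nonneg hs.1 hε.le, hdef⟩)
  refine ⟨sSup A, hext 0 h0, fun s hs ↦ ?_, fun hdef ↦ (hext _ ⟨(hext 0 h0).le, hdef⟩).false⟩
  obtain ⟨s', hs', hlt⟩ := exists_lt_of_lt_csSup ⟨0, h0⟩ hs.2
  exact hs'.2.mono ⟨hs.1, hlt.le⟩

/-- By uniqueness the curves for different final times restrict to each other, so one curve serves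
for the whole half-open interval. -/
theorem exists_orth_curve (hX : IsSmoothField X) {S : ℝ} {p : M}
    (h : ∀ s ∈ Ico 0 S, ∃ q, OrthFlowTo Ω X s p q) :
    ∃ β : ℝ → M, ∀ s ∈ Ico 0 S, OrthFlowTo Ω X s p (β s) ∧
      IsMIntegralCurveOn (I := 𝓡 2) β (orthField Ω X) (Icc 0 s) := by
  have h' : ∀ s, ∃ q, s ∈ Ico 0 S → OrthFlowTo Ω X s p q := by
    intro s
    by_cases hs : s ∈ Ico 0 S
    · obtain ⟨q, hq⟩ := h s hs
      exact ⟨q, fun _ ↦ hq⟩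
    · exact ⟨p, fun h ↦ absurd h hs⟩
  choose β hβ using h'
  refine ⟨β, fun s hs ↦ ⟨hβ s hs, ?_⟩⟩
  obtain ⟨α, h0, -, hreg, hα⟩ := hβ s hs
  refine isMIntegralCurveOn_congr hα fun r hr ↦ ?_
  exact (hβ r ⟨hr.1, hr.2.trans_lt hs.2⟩).unique hX hr.1 ⟨α, h0, rfl,
    fun u hu ↦ hreg u ⟨hu.1, hu.2.trans hr.2⟩, hα.mono (Icc_subset_Icc_right hr.2)⟩

theorem OrthFlowTo.of_tendsto (hX : IsSmoothField X) {S : ℝ} (hS : 0 < S) {β : ℝ → M} {p q : M}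
    (hβ : ∀ s ∈ Ico 0 S, OrthFlowTo Ω X s p (β s) ∧
      IsMIntegralCurveOn (I := 𝓡 2) β (orthField Ω X) (Icc 0 s))
    (hq : Tendsto β (𝓝[<] S) (𝓝 q)) (hqZ : q ∉ fixedPts X) : OrthFlowTo Ω X S p q := by
  have hIco : IsMIntegralCurveOn (I := 𝓡 2) β (orthField Ω X) (Ico 0 S) := by
    intro s hs
    have hm : s < (s + S) / 2 := by linarith [hs.2]
    refine ((hβ ((s + S) / 2) ⟨hs.1.trans hm.le, by linarith [hs.2]⟩).2 s
      ⟨hs.1, hm.le⟩).mono_of_mem_nhdsWithin ?_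
    rw [mem_nhdsWithin]
    exact ⟨Iio ((s + S) / 2), isOpen_Iio, hm, fun r hr ↦ ⟨hr.2.1, le_of_lt hr.1⟩⟩
  have h0 : β 0 = p := (hβ 0 ⟨le_rfl, hS⟩).1.elim fun α hα ↦ hα.2.1 ▸ hα.1
  refine ⟨Function.update β S q, by rw [Function.update_of_ne hS.ne, h0], by simp, fun r hr ↦ ?_,
    isMIntegralCurveOn_update hS hIco hq (isC1At_orthField hX hqZ)⟩
  rcases hr.2.eq_or_lt with rfl | hlt
  · simpa using hqZ
  · rw [Function.update_of_ne hlt.ne]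
    exact (hβ r ⟨hr.1, hlt⟩).1.notMem_fixedPts hr.1

theorem OrthFlowTo.tendsto (hX : IsSmoothField X) {S : ℝ} (hS : 0 < S) {β : ℝ → M} {p q : M}
    (hβ : ∀ s ∈ Ico 0 S, OrthFlowTo Ω X s p (β s)) (h : OrthFlowTo Ω X S p q) :
    Tendsto β (𝓝[<] S) (𝓝 q) := by
  obtain ⟨α, h0, rfl, hreg, hα⟩ := h
  have hlim : Tendsto α (𝓝[<] S) (𝓝 (α S)) :=
    ((hα.continuousOn S ⟨hS.le, le_rfl⟩).mono_of_mem_nhdsWithin (Icc_mem_nhdsLT hS)).tendsto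
  refine hlim.congr' ?_
  filter_upwards [Ico_mem_nhdsLT hS] with r hr
  exact OrthFlowTo.unique hX hr.1 ⟨α, h0, rfl, fun u hu ↦ hreg u ⟨hu.1, hu.2.trans hr.2.le⟩,
    hα.mono (Icc_subset_Icc_right hr.2.le)⟩ (hβ r hr)

theorem continuousOn_orthFlow (hX : IsSmoothField X) (hφ : IsSmoothFlowOf φ X)
    (hφΩ : PreservesArea φ Ω) {f : ℝ → M} {s T : ℝ} {x₀ : M} (hs : 0 ≤ s)
    (hf : ∀ t ∈ Icc 0 T, OrthFlowTo Ω X s (φ t x₀) (f t)) : ContinuousOn f (Icc 0 T) := by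
  intro t ht
  obtain ⟨δ, hδ, θ, -, hθc, hθ0, hθ⟩ := (hf t ht).exists_strip hX hφ hφΩ hs
  have hc : Continuous fun t' ↦ φ (θ (t' - t)) (f t) :=
    φ.continuous (hθc.comp (continuous_id.sub continuous_const)) continuous_const
  refine hc.continuousWithinAt.congr_of_eventuallyEq ?_ ?_
  · filter_upwards [self_mem_nhdsWithin, mem_nhdsWithin_of_mem_nhds (Metric.ball_mem_nhds t hδ)]
      with t' ht' htt'
    have := hθ (t' - t) htt'
    rw [← φ.map_add, sub_add_cancel] at this
    exact (hf t' ht').unique hX hs this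
  · rw [sub_self, hθ0, φ.map_zero_apply]

/-- If `g t` is not fixed, the strip around the orthogonal trajectory ending there reaches time `S`
inclusive. So nearby values of `g` are `φ (θ (r - t)) (g t)` with `θ` monotone and continuous. -/
theorem isLocallyArc_limit (hX : IsSmoothField X) (hφ : IsSmoothFlowOf φ X)
    (hφΩ : PreservesArea φ Ω) {S T : ℝ} {x₀ : M} {g : ℝ → M} (hS : 0 < S)
    (hg : ∀ t ∈ Icc 0 T, g t ∉ fixedPts X → OrthFlowTo Ω X S (φ t x₀) (g t))
    (hg' : ∀ t ∈ Icc 0 T, ∀ q, OrthFlowTo Ω X S (φ t x₀) q → g t = q) :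
    IsLocallyArc φ g (fixedPts X) T := by
  intro t ht hZ
  obtain ⟨δ, hδ, θ, hθm, hθc, -, hθ⟩ := (hg t ht hZ).exists_strip hX hφ hφΩ hS.le
  have key : ∀ r ∈ Icc 0 T, |r - t| < δ → g r = φ (θ (r - t)) (g t) := by
    intro r hr hrt
    have := hθ (r - t) hrt
    rw [← φ.map_add, sub_add_cancel] at this
    exact hg' r hr _ this
  refine ⟨δ, hδ, fun t' ht' t'' ht'' hd' hd'' hle ↦ ?_⟩
  have hsubI : ∀ r ∈ Icc t' t'', g r = φ (θ (r - t)) (g t) := by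
    intro r hr
    refine key r ⟨ht'.1.trans hr.1, hr.2.trans ht''.2⟩ ?_
    rw [abs_lt] at hd' hd'' ⊢
    constructor <;> linarith [hr.1, hr.2]
  have e' := hsubI t' ⟨le_rfl, hle⟩
  have e'' := hsubI t'' ⟨hle, le_rfl⟩
  have hshift : ∀ u, φ u (g t') = φ (u + θ (t' - t)) (g t) := fun u ↦ by rw [φ.map_add, e']
  have hmt : θ (t' - t) ≤ θ (t'' - t) := hθm (by linarith)
  refine ⟨θ (t'' - t) - θ (t' - t), sub_nonneg.2 hmt, by rw [hshift, sub_add_cancel, e''], ?_⟩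
  apply Subset.antisymm
  · rintro _ ⟨r, hr, rfl⟩
    refine ⟨θ (r - t) - θ (t' - t), ⟨sub_nonneg.2 (hθm (by linarith [hr.1])),
      sub_le_sub_right (hθm (by linarith [hr.2])) _⟩, ?_⟩
    simp only
    rw [hshift, sub_add_cancel, hsubI r hr]
  · rintro _ ⟨u, hu, rfl⟩
    -- Continuity of `θ` ensures that no point of the flow segment is skipped.
    obtain ⟨r, hr, hru⟩ := intermediate_value_Icc (f := fun r ↦ θ (r - t)) hle
      (hθc.comp (continuous_id.sub continuous_const)).continuousOn
      (show u + θ (t' - t) ∈ Icc (θ (t' - t)) (θ (t'' - t)) from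
        ⟨by linarith [hu.1], by linarith [hu.2]⟩)
    refine ⟨r, hr, ?_⟩
    simp only at hru ⊢
    rw [hshift, hsubI r hr, hru]

theorem orthImage_trajSegment (hX : IsSmoothField X) {f : ℝ → M} {s T : ℝ} {x₀ : M} (hs : 0 ≤ s)
    (hf : ∀ t ∈ Icc 0 T, OrthFlowTo Ω X s (φ t x₀) (f t)) :
    orthImage Ω X s (trajSegment φ x₀ T) = f '' Icc 0 T := by
  apply Subset.antisymm
  · rintro q ⟨_, ⟨t, ht, rfl⟩, hq⟩
    exact ⟨t, ht, (hf t ht).unique hX hs hq⟩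
  · rintro _ ⟨t, ht, rfl⟩
    exact ⟨_, mem_image_of_mem _ ht, hf t ht⟩

end OrthogonalFlow

/-! ### Joint limits of families of paths. -/

section PathLimit

variable {M : Type*} [EMetricSpace M] {S : ℝ} {f : ℝ → ℝ → M} {g : ℝ → M} {K : Set ℝ}

theorem continuousOn_limit
    (h : ∀ t ∈ K, Tendsto (fun z : ℝ × ℝ ↦ f z.2 z.1) (𝓝[<] S ×ˢ 𝓝[K] t) (𝓝 (g t)))
    (hlim : ∀ t ∈ K, Tendsto (f t) (𝓝[<] S) (𝓝 (g t))) : ContinuousOn g K := by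
  intro t ht
  refine (closed_nhds_basis (g t)).tendsto_right_iff.2 fun B hB ↦ ?_
  have := (h t ht hB.1)
  rw [mem_map, mem_prod_iff] at this
  obtain ⟨U, hU, V, hV, hUV⟩ := this
  filter_upwards [hV, self_mem_nhdsWithin] with t' ht' htK
  exact hB.2.mem_of_tendsto (hlim t' htK) (mem_of_superset hU fun s hs ↦ hUV (mk_mem_prod hs ht'))

/-- Joint convergence at each `t` gives uniform convergence on the compact set `K`, and the uniform
distance dominates the Hausdorff distance of the images. -/
theorem tendsto_hausdorffEDist_image (hK : IsCompact K)
    (h : ∀ t ∈ K, Tendsto (fun z : ℝ × ℝ ↦ f z.2 z.1) (𝓝[<] S ×ˢ 𝓝[K] t) (𝓝 (g t)))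
    (hg : ContinuousOn g K) :
    Tendsto (fun s ↦ Metric.hausdorffEDist ((fun t ↦ f t s) '' K) (g '' K)) (𝓝[<] S) (𝓝 0) := by
  have hunif : TendstoUniformlyOn (fun s t ↦ f t s) g (𝓝[<] S) K := by
    rw [← tendstoLocallyUniformlyOn_iff_tendstoUniformlyOn_of_compact hK,
      tendstoLocallyUniformlyOn_iff_forall_tendsto]
    intro t ht
    exact (((hg t ht).tendsto.comp tendsto_snd).prodMk_nhds (h t ht)).mono_right
      (nhds_le_uniformity _)
  rw [EMetric.tendstoUniformlyOn_iff] at hunif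
  rw [ENNReal.tendsto_nhds_zero]
  intro ε hε
  filter_upwards [hunif ε hε] with s hs
  refine Metric.hausdorffEDist_le_of_mem_edist ?_ ?_
  · rintro _ ⟨t, ht, rfl⟩
    exact ⟨g t, mem_image_of_mem g ht, by rw [edist_comm]; exact (hs t ht).le⟩
  · rintro _ ⟨t, ht, rfl⟩
    exact ⟨f t s, mem_image_of_mem _ ht, (hs t ht).le⟩

end PathLimit

/-! ### Convergence of orthogonal trajectories at the end time. -/

section Limit

variable {M : Type*} [EMetricSpace M] [CompactSpace M] [ChartedSpace (EuclideanSpace ℝ (Fin 2)) M]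
  [IsManifold (𝓡 2) ∞ M] [Bundle.RiemannianBundle (fun x : M ↦ TangentSpace (𝓡 2) x)]
  [IsContMDiffRiemannianBundle (𝓡 2) ∞ (EuclideanSpace ℝ (Fin 2))
    (fun x : M ↦ TangentSpace (𝓡 2) x)]
  {Ω : AreaForm M} {X : (x : M) → TangentSpace (𝓡 2) x} {φ : Flow ℝ M}

/-- A cluster point `q` exists by compactness. Once the curve is in the small neighbourhood `B'`
with less than `η` of time left, the barrier keeps it in `B` until time `S`. -/
theorem exists_tendsto_of_isMIntegralCurveOn (hX : IsSmoothField X) (hfix : (fixedPts X).Finite)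
    {S : ℝ} (hS : 0 < S) {β : ℝ → M}
    (hβ : ∀ s ∈ Ico 0 S, IsMIntegralCurveOn (I := 𝓡 2) β (orthField Ω X) (Icc 0 s)) :
    ∃ q, Tendsto β (𝓝[<] S) (𝓝 q) := by
  obtain ⟨q, hq⟩ := exists_clusterPt_of_compactSpace (map β (𝓝[<] S))
  refine ⟨q, fun B hB ↦ ?_⟩
  obtain ⟨B', hB', η, hη, hbar⟩ :=
    exists_nhds_barrier hfix (fun p hp ↦ isC1At_orthField (Ω := Ω) hX hp) q hB
  have hfr : ∃ᶠ s in 𝓝[<] S, β s ∈ B' := hq.frequently hB'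
  obtain ⟨s, hsB, hs⟩ := (hfr.and_eventually
    (Ioo_mem_nhdsLT (max_lt hS (sub_lt_self S hη)))).exists
  have hs0 : 0 < s := (le_max_left _ _).trans_lt hs.1
  have hsη : S - η < s := (le_max_right _ _).trans_lt hs.1
  refine mem_map.2 (mem_of_superset (Ioo_mem_nhdsLT hs.2) fun r hr ↦ ?_)
  exact hbar β s r ((hβ r ⟨(hs0.trans hr.1).le, hr.2⟩).mono (Icc_subset_Icc_left hs0.le)) hsB
    (by linarith [hr.2]) r ⟨hr.1.le, le_rfl⟩

variable {S T : ℝ} {x₀ : M} {F : ℝ → ℝ → M}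

/-- The barrier is the same for all curves. At a time `s` with `S - s < η`, continuity of the
orthogonal flow at the fixed time `s` puts all curves with nearby starting points in `B'`, so they
stay in `B` together. -/
theorem tendsto_orthFlow_prod (hX : IsSmoothField X) (hφ : IsSmoothFlowOf φ X)
    (hφΩ : PreservesArea φ Ω) (hfix : (fixedPts X).Finite) (hS : 0 < S)
    (hF : ∀ t ∈ Icc 0 T, ∀ s ∈ Ico 0 S, OrthFlowTo Ω X s (φ t x₀) (F t s) ∧
      IsMIntegralCurveOn (I := 𝓡 2) (F t) (orthField Ω X) (Icc 0 s)) {t : ℝ} (ht : t ∈ Icc 0 T)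
    {q : M} (hq : Tendsto (F t) (𝓝[<] S) (𝓝 q)) :
    Tendsto (fun z : ℝ × ℝ ↦ F z.2 z.1) (𝓝[<] S ×ˢ 𝓝[Icc 0 T] t) (𝓝 q) := by
  intro B hB
  obtain ⟨B', hB', η, hη, hbar⟩ :=
    exists_nhds_barrier hfix (fun p hp ↦ isC1At_orthField (Ω := Ω) hX hp) q hB
  obtain ⟨s, hsB, hs⟩ := ((hq.eventually (eventually_mem_nhds_iff.2 hB')).and
    (Ioo_mem_nhdsLT (max_lt hS (sub_lt_self S hη)))).exists
  have hs0 : 0 < s := (le_max_left _ _).trans_lt hs.1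
  have hsη : S - η < s := (le_max_right _ _).trans_lt hs.1
  have hct : ∀ᶠ t' in 𝓝[Icc 0 T] t, F t' s ∈ B' :=
    (continuousOn_orthFlow (f := fun t ↦ F t s) hX hφ hφΩ hs0.le
      fun t' ht' ↦ (hF t' ht' s ⟨hs0.le, hs.2⟩).1) t ht hsB
  have h1 : ∀ᶠ r in 𝓝[<] S, r ∈ Ioo s S := Ioo_mem_nhdsLT hs.2
  refine mem_map.2 ?_
  filter_upwards [h1.prod_mk (hct.and self_mem_nhdsWithin)] with z hz
  obtain ⟨hr, htB, htI⟩ := hz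
  exact hbar (F z.2) s z.1 (((hF z.2 htI z.1 ⟨(hs0.trans hr.1).le, hr.2⟩).2).mono
    (Icc_subset_Icc_left hs0.le)) htB (by linarith [hr.2]) z.1 ⟨hr.1.le, le_rfl⟩

end Limit

end SurfaceFlow

theorem mainTheorem9 {M : Type*} [EMetricSpace M] [CompactSpace M] [ConnectedSpace M]
    [ChartedSpace (EuclideanSpace ℝ (Fin 2)) M] [IsManifold (𝓡 2) ∞ M]
    [Bundle.RiemannianBundle (fun x : M ↦ TangentSpace (𝓡 2) x)]
    [IsContMDiffRiemannianBundle (𝓡 2) ∞ (EuclideanSpace ℝ (Fin 2))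
      (fun x : M ↦ TangentSpace (𝓡 2) x)]
    [IsRiemannianManifold (𝓡 2) M]
    (Ω : SurfaceFlow.AreaForm M) (hΩ : SurfaceFlow.IsConsistentMetric Ω)
    (X : (x : M) → TangentSpace (𝓡 2) x) (hX : SurfaceFlow.IsSmoothField X)
    (φ : Flow ℝ M) (hφ : SurfaceFlow.IsSmoothFlowOf φ X) (hφΩ : SurfaceFlow.PreservesArea φ Ω)
    (hfix : (SurfaceFlow.fixedPts X).Finite)
    (hsep : {σ : Set M | SurfaceFlow.IsStableSeparatrix φ X σ ∨
      SurfaceFlow.IsUnstableSeparatrix φ X σ}.Finite)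
    (x₀ : M) (hx₀ : x₀ ∉ SurfaceFlow.fixedPts X) (T : ℝ) (hT : 0 < T) :
    (∀ s : ℝ, 0 < s →
      SurfaceFlow.OrthDefinedOn Ω X s (SurfaceFlow.trajSegment φ x₀ T)) ∨
    ∃ sStar : ℝ, 0 < sStar ∧
      (∀ s ∈ Ico 0 sStar,
        SurfaceFlow.OrthDefinedOn Ω X s (SurfaceFlow.trajSegment φ x₀ T)) ∧
      ∃ L : Set M,
        Tendsto (fun s : ℝ ↦ Metric.hausdorffEDist
          (SurfaceFlow.orthImage Ω X s (SurfaceFlow.trajSegment φ x₀ T)) L) (𝓝[<] sStar) (𝓝 0) ∧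
        (SurfaceFlow.IsSeparatrixPath φ Ω X L ∨ ∃ p ∈ SurfaceFlow.fixedPts X, L = {p}) := by
  open SurfaceFlow in
  refine or_iff_not_imp_left.2 fun hnot ↦ ?_
  obtain ⟨S, hS, hdef, hundef⟩ := exists_maximal_time hX hφ hφΩ hfix.isClosed hx₀ hnot
  have hcurve : ∀ t, ∃ β : ℝ → M, t ∈ Icc 0 T → ∀ s ∈ Ico 0 S, OrthFlowTo Ω X s (φ t x₀) (β s) ∧
      IsMIntegralCurveOn (I := 𝓡 2) β (orthField Ω X) (Icc 0 s) := by
    intro t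
    by_cases ht : t ∈ Icc 0 T
    · obtain ⟨β, hβ⟩ := exists_orth_curve hX
        (fun s hs ↦ hdef s hs (φ t x₀) (mem_image_of_mem (fun t ↦ φ t x₀) ht))
      exact ⟨β, fun _ ↦ hβ⟩
    · exact ⟨fun _ ↦ x₀, fun h ↦ absurd h ht⟩
  choose F hF using hcurve
  have hlim : ∀ t, ∃ q, t ∈ Icc 0 T → Tendsto (F t) (𝓝[<] S) (𝓝 q) := by
    intro t
    by_cases ht : t ∈ Icc 0 T
    · obtain ⟨q, hq⟩ :=
        exists_tendsto_of_isMIntegralCurveOn hX hfix hS fun s hs ↦ (hF t ht s hs).2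
      exact ⟨q, fun _ ↦ hq⟩
    · exact ⟨x₀, fun h ↦ absurd h ht⟩
  choose g hg using hlim
  have hjoint := fun t ht ↦ tendsto_orthFlow_prod hX hφ hφΩ hfix hS hF ht (hg t ht)
  have hcont : ContinuousOn g (Icc 0 T) := continuousOn_limit hjoint hg
  have hto : ∀ t ∈ Icc 0 T, g t ∉ fixedPts X → OrthFlowTo Ω X S (φ t x₀) (g t) :=
    fun t ht hZ ↦ OrthFlowTo.of_tendsto hX hS (hF t ht) (hg t ht) hZ
  refine ⟨S, hS, hdef, g '' Icc 0 T, ?_, isSeparatrixPath_or_singleton hX hφ hφΩ hfix hsep hcont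
    (isLocallyArc_limit hX hφ hφΩ hS hto fun t ht q hq ↦ tendsto_nhds_unique (hg t ht)
      (OrthFlowTo.tendsto hX hS (fun s hs ↦ (hF t ht s hs).1) hq)) ?_⟩
  · refine (tendsto_hausdorffEDist_image isCompact_Icc hjoint hcont).congr' ?_
    filter_upwards [Ico_mem_nhdsLT hS] with s hs
    rw [orthImage_trajSegment hX hs.1 fun t ht ↦ (hF t ht s hs).1]
  -- If no limit were fixed, every orthogonal trajectory would extend to time `S`, contradicting its
  -- choice.
  · by_contra! hne
    refine hundef ?_
    rintro _ ⟨t, ht, rfl⟩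
    exact ⟨_, hto t ht (hne t ht)⟩
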